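/- Let $d\ge 1$ be an integer and let $p>d$ and $q>0$ be real numbers. Consider the radial problem $$(|u'|^{p-2}u')'+\frac{d-1}{r}|u'|^{p-2}u'=u^q\quad (0<r<\infty),\qquad \lim_{r\to0^+}u(r)=1,\quad \lim_{r\to\infty}u(r)=0. \tag{P}$$ A $C^1$ non-increasing solution of (P) is a non-increasing function $u\in C^1(0,\infty)$ (hence $u\ge 0$) that has the two limits in (P) and satisfies the equation in the distribution sense, that is, $$-\int_0^\infty \phi'\,r^{d-1}|u'|^{p-2}u'\,dr=\int_0^\infty \phi\,r^{d-1}u^q\,dr\qquad\text{for all }\phi\in C^1_c(0,\infty).$$ Then (P) has a $C^1$ non-increasing solution. Moreover, for every $C^1$ non-increasing solution $u$ of (P), the function $|u'|^{p-2}u'$ is differentiable on $(0,\infty)$, the equation holds at every $r>0$, and (i) $u'(r)<0$ for every $r>0$ with $u(r)>0$; (ii) the functions $r^{d-1}|u'|^p$, $r^{d-1}u^{q+1}$ and $r^{d-1}u^q$ are integrable on $(0,\infty)$, the limit below exists, and $$\int_0^\infty r^{d-1}|u'|^p\,dr+\int_0^\infty r^{d-1}u^{q+1}\,dr=\lim_{r\to0^+}r^{d-1}|u'(r)|^{p-1}=\int_0^\infty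 r^{d-1}u^q\,dr.$$ -/

import Mathlib

open Set Filter Topology MeasureTheory

/-- The flux `|u'|^{p-2} u'`, as a function of the radius. For `p > 1` it vanishes wherever `u'`
does (also when `p < 2`), which is the continuous extension of `t ↦ |t|^{p-2} t` at `0`. -/
noncomputable def pFlux (p : ℝ) (u : ℝ → ℝ) (r : ℝ) : ℝ :=
  |deriv u r| ^ (p - 2) * deriv u r

/-- `u` solves `(|u'|^{p-2} u')' + (d-1)/r |u'|^{p-2} u' = u^q` on `(0, ∞)` in the distribution
sense, in the divergence form `(r^{d-1} |u'|^{p-2} u')' = r^{d-1} u^q`, tested against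
`φ ∈ C^1_c(0, ∞)`. -/
def SolvesWeakly (d : ℕ) (p q : ℝ) (u : ℝ → ℝ) : Prop :=
  ∀ φ : ℝ → ℝ, ContDiff ℝ 1 φ → HasCompactSupport φ → tsupport φ ⊆ Ioi 0 →
    -∫ r in Ioi (0 : ℝ), deriv φ r * (r ^ (d - 1) * pFlux p u r)
      = ∫ r in Ioi (0 : ℝ), φ r * (r ^ (d - 1) * u r ^ q)

/-- `u` solves the same equation pointwise on `(0, ∞)`: the flux is differentiable, with the
derivative that the equation prescribes. -/
def SolvesPointwise (d : ℕ) (p q : ℝ) (u : ℝ → ℝ) : Prop :=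
  ∀ r : ℝ, 0 < r →
    DifferentiableAt ℝ (pFlux p u) r ∧
      deriv (pFlux p u) r + ((d : ℝ) - 1) / r * pFlux p u r = u r ^ q

/-- `C^1` non-increasing solutions of the radial problem with `u(0+) = 1` and `u(∞) = 0`.
Only the values on `(0, ∞)` matter; monotonicity and the limit at infinity force `u ≥ 0` there,
so that `u ^ q` is the usual power. -/
structure IsC1NonincreasingSolution (d : ℕ) (p q : ℝ) (u : ℝ → ℝ) : Prop where
  contDiffOn : ContDiffOn ℝ 1 u (Ioi 0)
  antitoneOn : AntitoneOn u (Ioi 0)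
  equation : SolvesWeakly d p q u
  tendsto_zero : Tendsto u (𝓝[>] 0) (𝓝 1)
  tendsto_atTop : Tendsto u atTop (𝓝 0)

/-! The weighted flux `W = r^(d-1) |u'|^(p-1)` of a non-increasing solution satisfies `W' = -r^(d-1)
u^q` and `u' = -r^(-γ) W^κ`, with `γ = (d-1)/(p-1)` and `κ = 1/(p-1)`. Since `p > d` means `γ < 1`,
the slope is integrable at `0`, and one may shoot from `u(0) = 1` with a finite initial flux `m`.

Existence: neither power need be Lipschitz at `0`, so profiles need not be unique. The integral
operator is order preserving in `u` and decreasing in `m` (`shootMap_mono`), so each `m` has a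
greatest profile, decreasing in `m`. Let `M` be the supremum of those `m` whose greatest profile
drives the flux negative; `M` is finite because a large `m` pushes `u` below `0` first, after which
the truncated source stops consuming flux. At `M` both `u` and the flux stay nonnegative: limits of
profiles from above and below `M` are profiles for `M`, and they are compared with the greatest one
through `exists_flux_neg` and `nonneg_of_flux_neg`.

Properties: du Bois-Reymond turns the weak equation into the pointwise law for `W`. Then `W`
decreases from a finite limit at `0` to `0` at infinity, and integrating `W'` and `(u W)'` gives the
two identities. -/

/-- The power `x ^ q` of the truncation of `x` to `[0, 1]`. -/
noncomputable def clampPow (q x : ℝ) : ℝ := (max 0 (min x 1)) ^ q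

/-- The weighted flux `m - ∫₀ˢ τ^(d-1) u^q` of the profile `u` with initial flux `m`. -/
noncomputable def shootFlux (d : ℕ) (q m : ℝ) (u : ℝ → ℝ) (s : ℝ) : ℝ :=
  m - ∫ τ in (0 : ℝ)..s, τ ^ (d - 1) * clampPow q (u τ)

/-- The shooting operator. Its fixed points are the profiles with `u(0) = 1`, initial flux `m`
and `u' = -r^(-γ) w^κ`, where `w` is the positive part of the flux. -/
noncomputable def shootMap (d : ℕ) (γ κ q m : ℝ) (u : ℝ → ℝ) (r : ℝ) : ℝ :=
  1 - ∫ s in (0 : ℝ)..r, s ^ (-γ) * (max 0 (shootFlux d q m u s)) ^ κ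

/-! ### The shooting operator: monotonicity and continuity. -/

section Shooting

variable {d : ℕ} {γ κ q m : ℝ} {u v : ℝ → ℝ}

lemma clampPow_nonneg (x : ℝ) : 0 ≤ clampPow q x := by
  unfold clampPow; positivity

lemma clampPow_le_one (hq : 0 < q) (x : ℝ) : clampPow q x ≤ 1 :=
  Real.rpow_le_one (le_max_left _ _) (max_le zero_le_one (min_le_right _ _)) hq.le

lemma clampPow_mono (hq : 0 < q) : Monotone (clampPow q) := fun _ _ h =>
  Real.rpow_le_rpow (le_max_left _ _) (max_le_max le_rfl (min_le_min h le_rfl)) hq.le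

lemma continuous_clampPow (hq : 0 < q) : Continuous (clampPow q) :=
  (continuous_const.max (continuous_id.min continuous_const)).rpow_const fun _ => Or.inr hq.le

lemma clampPow_of_nonpos (hq : 0 < q) {x : ℝ} (hx : x ≤ 0) : clampPow q x = 0 := by
  have : max 0 (min x 1) = 0 := max_eq_left ((min_le_left _ _).trans hx)
  rw [clampPow, this, Real.zero_rpow hq.ne']

lemma clampPow_of_mem {x : ℝ} (h0 : 0 ≤ x) (h1 : x ≤ 1) : clampPow q x = x ^ q := by
  rw [clampPow, min_eq_left h1, max_eq_right h0]

lemma measurable_source (hq : 0 < q) (hu : Measurable u) :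
    Measurable fun τ : ℝ => τ ^ (d - 1) * clampPow q (u τ) :=
  (measurable_id.pow_const _).mul ((continuous_clampPow hq).measurable.comp hu)

lemma norm_source_le (hq : 0 < q) (x τ : ℝ) :
    ‖τ ^ (d - 1) * clampPow q x‖ ≤ ‖τ ^ (d - 1)‖ := by
  rw [norm_mul, Real.norm_of_nonneg (clampPow_nonneg x)]
  exact mul_le_of_le_one_right (norm_nonneg _) (clampPow_le_one hq x)

lemma intervalIntegrable_source (hq : 0 < q) (hu : Measurable u) (a b : ℝ) :
    IntervalIntegrable (fun τ : ℝ => τ ^ (d - 1) * clampPow q (u τ)) volume a b :=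
  ((continuous_pow (d - 1)).intervalIntegrable a b).mono_fun
    (measurable_source hq hu).aestronglyMeasurable (ae_of_all _ fun τ => norm_source_le hq _ τ)

lemma source_nonneg {τ : ℝ} (hτ : 0 ≤ τ) (x : ℝ) : 0 ≤ τ ^ (d - 1) * clampPow q x :=
  mul_nonneg (pow_nonneg hτ _) (clampPow_nonneg x)

lemma shootFlux_sub (hq : 0 < q) (hu : Measurable u) (a b : ℝ) :
    shootFlux d q m u a - shootFlux d q m u b
      = ∫ τ in a..b, τ ^ (d - 1) * clampPow q (u τ) := by
  rw [shootFlux, shootFlux, ← intervalIntegral.integral_interval_sub_left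
    (intervalIntegrable_source hq hu 0 b) (intervalIntegrable_source hq hu 0 a)]
  ring

lemma continuous_shootFlux (hq : 0 < q) (hu : Measurable u) :
    Continuous (shootFlux d q m u) :=
  continuous_const.sub
    (intervalIntegral.continuous_primitive (fun a b => intervalIntegrable_source hq hu a b) 0)

lemma shootFlux_antitoneOn (hq : 0 < q) (hu : Measurable u) :
    AntitoneOn (shootFlux d q m u) (Ici 0) := by
  intro a ha b _ hab
  have h := shootFlux_sub (d := d) (m := m) hq hu a b
  have h2 : 0 ≤ ∫ τ in a..b, τ ^ (d - 1) * clampPow q (u τ) :=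
    intervalIntegral.integral_nonneg hab fun τ hτ => source_nonneg (le_trans ha hτ.1) _
  linarith

@[simp] lemma shootFlux_zero : shootFlux d q m u 0 = m := by simp [shootFlux]

lemma shootFlux_le (hq : 0 < q) (hu : Measurable u) {s : ℝ} (hs : 0 ≤ s) :
    shootFlux d q m u s ≤ m := by
  simpa using shootFlux_antitoneOn (m := m) (d := d) hq hu self_mem_Ici hs hs

/-- A larger profile consumes more flux. -/
lemma shootFlux_mono (hq : 0 < q) (hu : Measurable u) (hv : Measurable v) {m' : ℝ} (hm : m' ≤ m)
    (huv : ∀ r, 0 ≤ r → u r ≤ v r) {s : ℝ} (hs : 0 ≤ s) :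
    shootFlux d q m' v s ≤ shootFlux d q m u s := by
  refine sub_le_sub hm (intervalIntegral.integral_mono_on hs (intervalIntegrable_source hq hu 0 s)
    (intervalIntegrable_source hq hv 0 s) fun τ hτ => ?_)
  exact mul_le_mul_of_nonneg_left (clampPow_mono hq (huv τ hτ.1)) (pow_nonneg hτ.1 _)

lemma continuous_fluxPow (hκ : 0 < κ) (hq : 0 < q) (hu : Measurable u) :
    Continuous fun s => (max 0 (shootFlux d q m u s)) ^ κ :=
  (continuous_const.max (continuous_shootFlux hq hu)).rpow_const fun _ => Or.inr hκ.le

lemma intervalIntegrable_slope (hγ : γ < 1) (hκ : 0 < κ) (hq : 0 < q) (hu : Measurable u)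
    (a b : ℝ) :
    IntervalIntegrable (fun s : ℝ => s ^ (-γ) * (max 0 (shootFlux d q m u s)) ^ κ) volume a b :=
  (intervalIntegral.intervalIntegrable_rpow' (by linarith)).mul_continuousOn
    (continuous_fluxPow hκ hq hu).continuousOn

lemma slope_nonneg {s : ℝ} (hs : 0 ≤ s) (x : ℝ) : 0 ≤ s ^ (-γ) * (max 0 x) ^ κ := by positivity

lemma shootMap_sub (hγ : γ < 1) (hκ : 0 < κ) (hq : 0 < q) (hu : Measurable u) (a b : ℝ) :
    shootMap d γ κ q m u a - shootMap d γ κ q m u b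
      = ∫ s in a..b, s ^ (-γ) * (max 0 (shootFlux d q m u s)) ^ κ := by
  rw [shootMap, shootMap, ← intervalIntegral.integral_interval_sub_left
    (intervalIntegrable_slope hγ hκ hq hu 0 b) (intervalIntegrable_slope hγ hκ hq hu 0 a)]
  ring

lemma continuous_shootMap (hγ : γ < 1) (hκ : 0 < κ) (hq : 0 < q) (hu : Measurable u) :
    Continuous (shootMap d γ κ q m u) :=
  continuous_const.sub
    (intervalIntegral.continuous_primitive (fun a b => intervalIntegrable_slope hγ hκ hq hu a b) 0)

lemma shootMap_antitoneOn (hγ : γ < 1) (hκ : 0 < κ) (hq : 0 < q) (hu : Measurable u) :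
    AntitoneOn (shootMap d γ κ q m u) (Ici 0) := by
  intro a ha b _ hab
  have h := shootMap_sub (d := d) (m := m) hγ hκ hq hu a b
  have h2 : 0 ≤ ∫ s in a..b, s ^ (-γ) * (max 0 (shootFlux d q m u s)) ^ κ :=
    intervalIntegral.integral_nonneg hab fun s hs => slope_nonneg (le_trans ha hs.1) _
  linarith

@[simp] lemma shootMap_zero : shootMap d γ κ q m u 0 = 1 := by simp [shootMap]

lemma shootMap_le_one (hγ : γ < 1) (hκ : 0 < κ) (hq : 0 < q) (hu : Measurable u) {r : ℝ}
    (hr : 0 ≤ r) : shootMap d γ κ q m u r ≤ 1 := by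
  simpa using shootMap_antitoneOn (m := m) (d := d) hγ hκ hq hu self_mem_Ici hr hr

/-- Two reversals cancel: a larger profile leaves less flux, hence less descent. A smaller initial
flux acts in the same direction. -/
lemma shootMap_mono (hγ : γ < 1) (hκ : 0 < κ) (hq : 0 < q) (hu : Measurable u)
    (hv : Measurable v) {m' : ℝ} (hm : m' ≤ m) (huv : ∀ r, 0 ≤ r → u r ≤ v r) {r : ℝ}
    (hr : 0 ≤ r) : shootMap d γ κ q m u r ≤ shootMap d γ κ q m' v r := by
  refine sub_le_sub le_rfl (intervalIntegral.integral_mono_on hr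
    (intervalIntegrable_slope hγ hκ hq hv 0 r)
    (intervalIntegrable_slope hγ hκ hq hu 0 r) fun s hs => ?_)
  exact mul_le_mul_of_nonneg_left (Real.rpow_le_rpow (le_max_left _ _)
    (max_le_max le_rfl (shootFlux_mono hq hu hv hm huv hs.1)) hκ.le) (Real.rpow_nonneg hs.1 _)

lemma tendsto_shootFlux (hq : 0 < q) {mk : ℕ → ℝ} {uk : ℕ → ℝ → ℝ}
    (huk : ∀ k, Measurable (uk k)) (hm : Tendsto mk atTop (𝓝 m))
    (hlim : ∀ r, 0 ≤ r → Tendsto (fun k => uk k r) atTop (𝓝 (u r))) {s : ℝ} (hs : 0 ≤ s) :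
    Tendsto (fun k => shootFlux d q (mk k) (uk k) s) atTop (𝓝 (shootFlux d q m u s)) := by
  refine hm.sub (intervalIntegral.tendsto_integral_filter_of_dominated_convergence
    (fun τ => ‖τ ^ (d - 1)‖) (.of_forall fun k => (measurable_source hq (huk k)).aestronglyMeasurable)
    (.of_forall fun k => ae_of_all _ fun τ _ => norm_source_le hq _ τ)
    ((continuous_pow (d - 1)).norm.intervalIntegrable 0 s) (ae_of_all _ fun τ hτ => ?_))
  rw [uIoc_of_le hs] at hτ
  exact (((continuous_clampPow hq).tendsto _).comp (hlim τ hτ.1.le)).const_mul _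

/-- Dominated convergence: the fluxes are eventually at most `m + 1`, and `s^(-γ)` is integrable at
`0`. Letting `mk` vary serves the passage to the critical initial flux. -/
lemma tendsto_shootMap (hγ : γ < 1) (hκ : 0 < κ) (hq : 0 < q) {mk : ℕ → ℝ} {uk : ℕ → ℝ → ℝ}
    (huk : ∀ k, Measurable (uk k)) (hm : Tendsto mk atTop (𝓝 m))
    (hlim : ∀ r, 0 ≤ r → Tendsto (fun k => uk k r) atTop (𝓝 (u r))) {r : ℝ} (hr : 0 ≤ r) :
    Tendsto (fun k => shootMap d γ κ q (mk k) (uk k) r) atTop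
      (𝓝 (shootMap d γ κ q m u r)) := by
  have hbd : ∀ᶠ k in atTop, mk k ≤ m + 1 := (hm.eventually_lt_const (lt_add_one m)).mono
    fun _ h => h.le
  refine tendsto_const_nhds.sub (intervalIntegral.tendsto_integral_filter_of_dominated_convergence
    (fun s => s ^ (-γ) * (max 0 (m + 1)) ^ κ) (.of_forall fun k => ?_) ?_ ?_ ?_)
  · exact ((measurable_id.pow_const _).mul
      (continuous_fluxPow hκ hq (huk k)).measurable).aestronglyMeasurable
  · filter_upwards [hbd] with k hk
    refine ae_of_all _ fun s hs => ?_
    rw [uIoc_of_le hr] at hs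
    rw [Real.norm_of_nonneg (slope_nonneg hs.1.le _)]
    exact mul_le_mul_of_nonneg_left (Real.rpow_le_rpow (le_max_left _ _)
      (max_le_max le_rfl ((shootFlux_le hq (huk k) hs.1.le).trans hk)) hκ.le)
      (Real.rpow_nonneg hs.1.le _)
  · exact (intervalIntegral.intervalIntegrable_rpow' (by linarith)).mul_const _
  · refine ae_of_all _ fun s hs => ?_
    rw [uIoc_of_le hr] at hs
    exact ((tendsto_const_nhds.max (tendsto_shootFlux hq huk hm hlim hs.1.le)).rpow_const
      (Or.inr hκ.le)).const_mul _

/-! ### Greatest fixed points by monotone iteration. -/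

/-- The iterates of the shooting operator from the constant `1`. -/
noncomputable def shootIter (d : ℕ) (γ κ q m : ℝ) (n : ℕ) : ℝ → ℝ :=
  (shootMap d γ κ q m)^[n] fun _ => 1

/-- The greatest fixed point of the shooting operator. -/
noncomputable def shootMax (d : ℕ) (γ κ q m : ℝ) (r : ℝ) : ℝ :=
  ⨅ n, shootIter d γ κ q m n r

lemma shootIter_succ (n : ℕ) :
    shootIter d γ κ q m (n + 1) = shootMap d γ κ q m (shootIter d γ κ q m n) :=
  Function.iterate_succ_apply' _ _ _

lemma measurable_shootIter (hγ : γ < 1) (hκ : 0 < κ) (hq : 0 < q) (n : ℕ) :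
    Measurable (shootIter d γ κ q m n) := by
  induction n with
  | zero => exact measurable_const
  | succ n ih => rw [shootIter_succ]; exact (continuous_shootMap hγ hκ hq ih).measurable

lemma measurable_shootMax (hγ : γ < 1) (hκ : 0 < κ) (hq : 0 < q) :
    Measurable (shootMax d γ κ q m) :=
  Measurable.iInf fun n => measurable_shootIter hγ hκ hq n

lemma antitone_shootIter (hγ : γ < 1) (hκ : 0 < κ) (hq : 0 < q) {r : ℝ} (hr : 0 ≤ r) :
    Antitone fun n => shootIter d γ κ q m n r := by
  have h : ∀ n r, 0 ≤ r → shootIter d γ κ q m (n + 1) r ≤ shootIter d γ κ q m n r := by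
    intro n
    induction n with
    | zero =>
      intro r hr
      rw [shootIter_succ]
      exact shootMap_le_one hγ hκ hq (measurable_shootIter hγ hκ hq 0) hr
    | succ n ih =>
      intro r hr
      rw [shootIter_succ, shootIter_succ n]
      exact shootMap_mono hγ hκ hq (shootIter_succ (d := d) n ▸ measurable_shootIter hγ hκ hq _)
        (measurable_shootIter hγ hκ hq _) le_rfl (fun s hs => shootIter_succ (d := d) n ▸ ih s hs) hr
  exact antitone_nat_of_succ_le fun n => h n r hr

lemma bddBelow_shootIter (hγ : γ < 1) (hκ : 0 < κ) (hq : 0 < q) {r : ℝ} (hr : 0 ≤ r) :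
    BddBelow (range fun n => shootIter d γ κ q m n r) := by
  refine ⟨1 - ∫ s in (0 : ℝ)..r, s ^ (-γ) * (max 0 m) ^ κ, ?_⟩
  rintro _ ⟨n, rfl⟩
  -- Passing to the next iterate makes every term an image of the operator, where the flux is at
  -- most `m`.
  refine le_trans ?_ (antitone_shootIter hγ hκ hq hr n.le_succ)
  have hI := measurable_shootIter (d := d) (m := m) hγ hκ hq n
  simp only [shootIter_succ]
  refine sub_le_sub le_rfl (intervalIntegral.integral_mono_on hr
    (intervalIntegrable_slope hγ hκ hq hI 0 r)
    ((intervalIntegral.intervalIntegrable_rpow' (by linarith)).mul_const _) fun s hs => ?_)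
  exact mul_le_mul_of_nonneg_left (Real.rpow_le_rpow (le_max_left _ _)
    (max_le_max le_rfl (shootFlux_le hq hI hs.1)) hκ.le) (Real.rpow_nonneg hs.1 _)

lemma shootMax_eq (hγ : γ < 1) (hκ : 0 < κ) (hq : 0 < q) {r : ℝ} (hr : 0 ≤ r) :
    shootMax d γ κ q m r = shootMap d γ κ q m (shootMax d γ κ q m) r := by
  have hlim : ∀ r, 0 ≤ r → Tendsto (fun n => shootIter d γ κ q m n r) atTop
      (𝓝 (shootMax d γ κ q m r)) := fun r hr =>
    tendsto_atTop_ciInf (antitone_shootIter hγ hκ hq hr) (bddBelow_shootIter hγ hκ hq hr)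
  refine tendsto_nhds_unique ((hlim r hr).comp (tendsto_add_atTop_nat 1)) ?_
  simp only [Function.comp_def, shootIter_succ]
  exact tendsto_shootMap hγ hκ hq (fun n => measurable_shootIter hγ hκ hq n) tendsto_const_nhds
    hlim hr

/-- By monotonicity a subsolution stays below every iterate. Inequality in `hfix` suffices, which is
what makes comparison between different `m` possible. -/
lemma le_shootMax (hγ : γ < 1) (hκ : 0 < κ) (hq : 0 < q) (hv : Measurable v)
    (hfix : ∀ r, 0 ≤ r → v r ≤ shootMap d γ κ q m v r) {r : ℝ} (hr : 0 ≤ r) :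
    v r ≤ shootMax d γ κ q m r := by
  refine le_ciInf fun n => ?_
  induction n generalizing r with
  | zero => exact (hfix r hr).trans (shootMap_le_one hγ hκ hq hv hr)
  | succ n ih =>
    rw [shootIter_succ]
    exact (hfix r hr).trans (shootMap_mono hγ hκ hq hv (measurable_shootIter hγ hκ hq n) le_rfl
      (fun s hs => ih hs) hr)

lemma shootMax_anti (hγ : γ < 1) (hκ : 0 < κ) (hq : 0 < q) {m' : ℝ} (hm : m' ≤ m) {r : ℝ}
    (hr : 0 ≤ r) : shootMax d γ κ q m r ≤ shootMax d γ κ q m' r := by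
  have hM := measurable_shootMax (d := d) (m := m) hγ hκ hq
  refine le_shootMax hγ hκ hq hM (fun s hs => ?_) hr
  rw [shootMax_eq hγ hκ hq hs]
  refine (shootMap_mono hγ hκ hq hM hM hm (fun _ _ => le_rfl) hs)

end Shooting

/-! ### Choosing the critical initial flux. -/

section ShootingExistence

variable {d : ℕ} {γ κ q m : ℝ} {u v : ℝ → ℝ}

/-- Powers are smooth away from `0`; this gives local uniqueness as long as both the profile and its
flux are positive, whatever the exponents. -/
lemma exists_rpow_lipschitz_near (e : ℝ) {c : ℝ} (hc : 0 < c) :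
    ∃ K : ℝ, 0 ≤ K ∧ ∀ᶠ t in 𝓝 c ×ˢ 𝓝 c, |t.1 ^ e - t.2 ^ e| ≤ K * |t.1 - t.2| := by
  obtain ⟨K, t, ht, hK⟩ :=
    (Real.contDiffAt_rpow_const_of_ne (p := e) (n := 1) hc.ne').exists_lipschitzOnWith
  refine ⟨K, K.2, ?_⟩
  filter_upwards [prod_mem_prod ht ht] with x hx
  simpa [Real.dist_eq] using hK.dist_le_mul _ hx.1 _ hx.2

lemma shootFlux_eq_of_nonpos (hq : 0 < q) (hu : Measurable u) {a b : ℝ} (hab : a ≤ b)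
    (h : ∀ τ ∈ Icc a b, u τ ≤ 0) : shootFlux d q m u b = shootFlux d q m u a := by
  have h1 := shootFlux_sub (d := d) (m := m) hq hu a b
  have h2 : ∫ τ in a..b, τ ^ (d - 1) * clampPow q (u τ) = ∫ τ in a..b, (0 : ℝ) := by
    refine intervalIntegral.integral_congr fun τ hτ => ?_
    rw [uIcc_of_le hab] at hτ
    simp [clampPow_of_nonpos hq (h τ hτ)]
  rw [h2, intervalIntegral.integral_zero] at h1
  linarith

/-- `u` is a fixed point of the shooting operator with initial flux `m`, on `[0, ∞)`. -/
structure IsShootProfile (d : ℕ) (γ κ q m : ℝ) (u : ℝ → ℝ) : Prop where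
  measurable : Measurable u
  eq_shootMap : ∀ r, 0 ≤ r → u r = shootMap d γ κ q m u r

namespace IsShootProfile

lemma continuousOn (hu : IsShootProfile d γ κ q m u) (hγ : γ < 1) (hκ : 0 < κ) (hq : 0 < q) :
    ContinuousOn u (Ici 0) :=
  (continuous_shootMap hγ hκ hq hu.measurable).continuousOn.congr hu.eq_shootMap

lemma antitoneOn (hu : IsShootProfile d γ κ q m u) (hγ : γ < 1) (hκ : 0 < κ) (hq : 0 < q) :
    AntitoneOn u (Ici 0) :=
  (shootMap_antitoneOn hγ hκ hq hu.measurable).congr fun r hr => (hu.eq_shootMap r hr).symm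

lemma le_one (hu : IsShootProfile d γ κ q m u) (hγ : γ < 1) (hκ : 0 < κ) (hq : 0 < q) {r : ℝ}
    (hr : 0 ≤ r) : u r ≤ 1 :=
  hu.eq_shootMap r hr ▸ shootMap_le_one hγ hκ hq hu.measurable hr

lemma sub_eq (hu : IsShootProfile d γ κ q m u) (hγ : γ < 1) (hκ : 0 < κ) (hq : 0 < q) {a b : ℝ}
    (ha : 0 ≤ a) (hb : 0 ≤ b) :
    u a - u b = ∫ s in a..b, s ^ (-γ) * (max 0 (shootFlux d q m u s)) ^ κ := by
  rw [hu.eq_shootMap a ha, hu.eq_shootMap b hb, shootMap_sub hγ hκ hq hu.measurable]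

/-- If the flux becomes negative, the profile never does. -/
lemma nonneg_of_flux_neg (hu : IsShootProfile d γ κ q m u) (hγ : γ < 1) (hκ : 0 < κ) (hq : 0 < q)
    {R : ℝ} (hR : 0 ≤ R) (hW : shootFlux d q m u R < 0) {r : ℝ} (hr : 0 ≤ r) : 0 ≤ u r := by
  by_contra! hneg
  have hanti := shootFlux_antitoneOn (d := d) (m := m) hq hu.measurable
  have hua := hu.antitoneOn hγ hκ hq
  -- Beyond `r` the profile is negative and the flux is frozen, so it must already be negative at
  -- `r`.
  have hWr : shootFlux d q m u r < 0 := by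
    rcases le_total r R with h | h
    · rwa [← shootFlux_eq_of_nonpos hq hu.measurable h fun τ hτ =>
        (hua hr (mem_Ici.2 (hr.trans hτ.1)) hτ.1).trans hneg.le]
    · exact (hanti hR hr h).trans_lt hW
  -- Once the flux is nonpositive the profile stops moving.
  have key : ∀ a, 0 ≤ a → a ≤ r → shootFlux d q m u a ≤ 0 → u a = u r := by
    intro a ha har hWa
    have h1 := hu.sub_eq hγ hκ hq ha hr
    have h2 : ∫ s in a..r, s ^ (-γ) * (max 0 (shootFlux d q m u s)) ^ κ
        = ∫ s in a..r, (0 : ℝ) := by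
      refine intervalIntegral.integral_congr fun s hs => ?_
      rw [uIcc_of_le har] at hs
      have : max 0 (shootFlux d q m u s) = 0 :=
        max_eq_left ((hanti ha (mem_Ici.2 (ha.trans hs.1)) hs.1).trans hWa)
      simp [this, Real.zero_rpow hκ.ne']
    rw [h2, intervalIntegral.integral_zero] at h1
    linarith
  rcases le_or_gt m 0 with hm | hm
  · have h0 := key 0 le_rfl hr (by simpa using hm)
    rw [hu.eq_shootMap 0 le_rfl, shootMap_zero] at h0
    linarith
  -- At a zero `a` of the flux the profile already equals `u r < 0`, so the flux is frozen at `0` up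
  -- to `r`, contradicting `hWr`.
  · obtain ⟨a, ha, hWa⟩ := intermediate_value_Icc' hr
      (continuous_shootFlux (d := d) (m := m) hq hu.measurable).continuousOn
      (show (0 : ℝ) ∈ Icc _ _ from ⟨hWr.le, by simpa using hm.le⟩)
    have hua' := key a ha.1 ha.2 hWa.le
    have := shootFlux_eq_of_nonpos (d := d) (m := m) hq hu.measurable ha.2 fun τ hτ =>
      (hua ha.1 (mem_Ici.2 (ha.1.trans hτ.1)) hτ.1).trans (hua'.trans_lt hneg).le
    linarith

/-- Two ordered profiles with the same initial flux cannot separate before the flux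
of the larger one becomes negative. -/
lemma exists_flux_neg (hu : IsShootProfile d γ κ q m u) (hv : IsShootProfile d γ κ q m v)
    (hγ : γ < 1) (hκ : 0 < κ) (hq : 0 < q) (hvu : ∀ r, 0 ≤ r → v r ≤ u r) {R : ℝ} (hR : 0 ≤ R)
    (hW : shootFlux d q m u R < 0) : ∃ r, 0 ≤ r ∧ shootFlux d q m v r < 0 := by
  by_contra! hWv
  set Wu := shootFlux d q m u with hWu_def
  set Wv := shootFlux d q m v with hWv_def
  have hWuv : ∀ s, 0 ≤ s → Wu s ≤ Wv s := fun s hs =>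
    shootFlux_mono hq hv.measurable hu.measurable le_rfl hvu hs
  have hcu := hu.continuousOn hγ hκ hq
  have hcv := hv.continuousOn hγ hκ hq
  have hcWu : Continuous Wu := continuous_shootFlux hq hu.measurable
  have hcWv : Continuous Wv := continuous_shootFlux hq hv.measurable
  have hIu := fun a b => intervalIntegrable_slope (d := d) (m := m) hγ hκ hq hu.measurable a b
  have hIv := fun a b => intervalIntegrable_slope (d := d) (m := m) hγ hκ hq hv.measurable a b
  have hSu := fun a b => intervalIntegrable_source (d := d) hq hu.measurable a b
  have hSv := fun a b => intervalIntegrable_source (d := d) hq hv.measurable a b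
  -- differences are integrals of nonnegative quantities, hence monotone
  have hE : ∀ a b, 0 ≤ a → 0 ≤ b → (u b - v b) - (u a - v a)
      = ∫ s in a..b, (s ^ (-γ) * (max 0 (Wv s)) ^ κ - s ^ (-γ) * (max 0 (Wu s)) ^ κ) := by
    intro a b ha hb
    rw [intervalIntegral.integral_sub (hIv a b) (hIu a b), ← hu.sub_eq hγ hκ hq ha hb,
      ← hv.sub_eq hγ hκ hq ha hb]
    ring
  have hD : ∀ a b, (Wv b - Wu b) - (Wv a - Wu a)
      = ∫ τ in a..b, (τ ^ (d - 1) * clampPow q (u τ) - τ ^ (d - 1) * clampPow q (v τ)) := by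
    intro a b
    rw [intervalIntegral.integral_sub (hSu a b) (hSv a b), ← shootFlux_sub hq hu.measurable a b,
      ← shootFlux_sub hq hv.measurable a b]
    ring
  have hEmono : ∀ a b, 0 ≤ a → a ≤ b → u a - v a ≤ u b - v b := by
    intro a b ha hab
    have h := hE a b ha (ha.trans hab)
    have : 0 ≤ ∫ s in a..b,
        (s ^ (-γ) * (max 0 (Wv s)) ^ κ - s ^ (-γ) * (max 0 (Wu s)) ^ κ) := by
      refine intervalIntegral.integral_nonneg hab fun s hs => sub_nonneg.2 ?_
      have hs0 := ha.trans hs.1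
      exact mul_le_mul_of_nonneg_left (Real.rpow_le_rpow (le_max_left _ _)
        (max_le_max le_rfl (hWuv s hs0)) hκ.le) (Real.rpow_nonneg hs0 _)
    linarith
  have hDmono : ∀ a b, 0 ≤ a → a ≤ b → Wv a - Wu a ≤ Wv b - Wu b := by
    intro a b ha hab
    have h := hD a b
    have : 0 ≤ ∫ τ in a..b,
        (τ ^ (d - 1) * clampPow q (u τ) - τ ^ (d - 1) * clampPow q (v τ)) := by
      refine intervalIntegral.integral_nonneg hab fun s hs => sub_nonneg.2 ?_
      have hs0 := ha.trans hs.1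
      exact mul_le_mul_of_nonneg_left (clampPow_mono hq (hvu s hs0)) (pow_nonneg hs0 _)
    linarith
  -- The gap `u - v` is nonnegative and nondecreasing, so equality at `x` forces equality on all of
  -- `[0, x]`.
  have hflux_eq : ∀ x, 0 ≤ x → u x = v x → Wu x = Wv x := by
    intro x hx hxe
    refine congrArg (m - ·) (intervalIntegral.integral_congr fun s hs => ?_)
    rw [uIcc_of_le hx] at hs
    have h1 := hEmono s x hs.1 hs.2
    have h2 := hvu s hs.1
    have : u s = v s := by linarith
    simp [this]
  -- Continuation: the coincidence set is closed and extends to the right of each of its points in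
  -- `[0, R)`. On reaching `R` the two fluxes agree there, against their signs.
  have hsub : Icc 0 R ⊆ {x | u x = v x} := by
    refine IsClosed.Icc_subset_of_forall_exists_gt ?_ ?_ ?_
    · have h1 : ContinuousOn (fun x => u x - v x) (Icc 0 R) :=
        (hcu.sub hcv).mono Icc_subset_Ici_self
      have h2 := h1.preimage_isClosed_of_isClosed isClosed_Icc (isClosed_singleton (x := (0 : ℝ)))
      convert h2 using 1
      ext x
      simp [sub_eq_zero, and_comm]
    · simp [hu.eq_shootMap 0 le_rfl, hv.eq_shootMap 0 le_rfl]
    · rintro x ⟨hxe, hx0, hxR⟩ y hxy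
      have hxe : u x = v x := hxe
      have hWe := hflux_eq x hx0 hxe
      -- Otherwise the flux of `u` is frozen from `x` to `R`, although it is nonnegative at `x` and
      -- negative at `R`.
      have hux : 0 < u x := by
        by_contra! hux
        have h1 := shootFlux_eq_of_nonpos (d := d) (m := m) hq hu.measurable hxR.le fun τ hτ =>
          (hu.antitoneOn hγ hκ hq hx0 (mem_Ici.2 (hx0.trans hτ.1)) hτ.1).trans hux
        have h2 := hWv x hx0
        rw [← hWu_def] at h1
        linarith
      have hle : 𝓝[≥] x ≤ 𝓝[Ici 0] x := nhdsWithin_mono _ (Ici_subset_Ici.2 hx0)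
      have htu : Tendsto u (𝓝[≥] x) (𝓝 (u x)) := (hcu x hx0).mono_left hle
      have htv : Tendsto v (𝓝[≥] x) (𝓝 (u x)) := hxe ▸ (hcv x hx0).mono_left hle
      -- A zero flux at `x`, with `v` still positive just after, would make the flux of `v`
      -- negative.
      have hWx : 0 < Wu x := by
        rw [hWe]
        refine lt_of_le_of_ne (hWv x hx0) fun h0 => ?_
        obtain ⟨z, hz, hzs⟩ := mem_nhdsGE_iff_exists_Icc_subset.1 (htv.eventually_const_lt hux)
        have h1 := shootFlux_sub (d := d) (m := m) hq hv.measurable x z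
        have h2 : 0 < ∫ τ in x..z, τ ^ (d - 1) * clampPow q (v τ) := by
          refine intervalIntegral.intervalIntegral_pos_of_pos_on (hSv x z) (fun τ hτ => ?_) hz
          have hτ0 : 0 < τ := hx0.trans_lt hτ.1
          have hvτ : 0 < v τ := hzs ⟨hτ.1.le, hτ.2.le⟩
          rw [clampPow_of_mem hvτ.le (hv.le_one hγ hκ hq hτ0.le)]
          positivity
        have h3 := hWv z (hx0.trans (le_of_lt hz))
        rw [← hWv_def] at h1
        linarith
      obtain ⟨K, hK0, hK⟩ := exists_rpow_lipschitz_near q hux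
      obtain ⟨L, hL0, hL⟩ := exists_rpow_lipschitz_near κ hWx
      have htWu : Tendsto Wu (𝓝[≥] x) (𝓝 (Wu x)) := hcWu.continuousWithinAt
      have htWv : Tendsto Wv (𝓝[≥] x) (𝓝 (Wu x)) := hWe ▸ hcWv.continuousWithinAt
      have hIa := fun a b => intervalIntegral.intervalIntegrable_rpow' (a := a) (b := b)
        (show -1 < -γ by linarith)
      have hIb := fun a b => (continuous_pow (M := ℝ) (d - 1)).intervalIntegrable
        (μ := volume) a b
      -- The product of the Lipschitz constants and the integrals of both weights over `[x, z]` is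
      -- the contraction factor; the integrals shrink to `0` with the interval.
      have hθ : ∀ᶠ z in 𝓝[≥] x,
          L * (K * ∫ τ in x..z, τ ^ (d - 1)) * (∫ s in x..z, s ^ (-γ)) < 1 := by
        have hc : Continuous fun z =>
            L * (K * ∫ τ in x..z, τ ^ (d - 1)) * (∫ s in x..z, s ^ (-γ)) :=
          (continuous_const.mul (continuous_const.mul
            (intervalIntegral.continuous_primitive hIb x))).mul
            (intervalIntegral.continuous_primitive hIa x)
        refine (hc.continuousWithinAt (s := Ici x) (x := x)).eventually_lt_const ?_
        simp
      obtain ⟨z, hz, hzs⟩ := mem_nhdsGE_iff_exists_Icc_subset.1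
        ((htu.eventually_const_lt hux).and <| (htv.eventually_const_lt hux).and <|
        ((htu.prodMk htv).eventually hK).and <| ((htWv.prodMk htWu).eventually hL).and <|
        (htWu.eventually_const_lt hWx).and <| (htWv.eventually_const_lt hWx).and <|
        hθ.and (mem_nhdsWithin_of_mem_nhds (Iio_mem_nhds hxy)))
      have hxz : x < z := hz
      have hz0 : 0 ≤ z := hx0.trans hxz.le
      refine ⟨z, ?_, hxz, le_of_lt (hzs ⟨hxz.le, le_rfl⟩).2.2.2.2.2.2.2⟩
      have hEz := hE x z hx0 hz0
      have hDz := hD x z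
      have hEnn : 0 ≤ u z - v z := sub_nonneg.2 (hvu z hz0)
      have hD_le : Wv z - Wu z ≤ K * (∫ τ in x..z, τ ^ (d - 1)) * (u z - v z) := by
        have : (∫ τ in x..z, (τ ^ (d - 1) * clampPow q (u τ) - τ ^ (d - 1) * clampPow q (v τ)))
            ≤ ∫ τ in x..z, τ ^ (d - 1) * (K * (u z - v z)) := by
          refine intervalIntegral.integral_mono_on hxz.le ((hSu x z).sub (hSv x z))
            ((hIb x z).mul_const _) fun τ hτ => ?_
          have hτ0 := hx0.trans hτ.1
          obtain ⟨h1, h2, h3, -⟩ := hzs hτ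
          rw [← mul_sub, clampPow_of_mem h1.le (hu.le_one hγ hκ hq hτ0),
            clampPow_of_mem h2.le (hv.le_one hγ hκ hq hτ0)]
          refine mul_le_mul_of_nonneg_left ?_ (pow_nonneg hτ0 _)
          refine (le_abs_self _).trans (h3.trans (mul_le_mul_of_nonneg_left ?_ hK0))
          simp only
          rw [abs_of_nonneg (sub_nonneg.2 (hvu τ hτ0))]
          exact hEmono τ z hτ0 hτ.2
        rw [intervalIntegral.integral_mul_const] at this
        linarith
      have hE_le : u z - v z ≤ (∫ s in x..z, s ^ (-γ)) * (L * (Wv z - Wu z)) := by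
        have : (∫ s in x..z, (s ^ (-γ) * (max 0 (Wv s)) ^ κ - s ^ (-γ) * (max 0 (Wu s)) ^ κ))
            ≤ ∫ s in x..z, s ^ (-γ) * (L * (Wv z - Wu z)) := by
          refine intervalIntegral.integral_mono_on hxz.le ((hIv x z).sub (hIu x z))
            ((hIa x z).mul_const _) fun τ hτ => ?_
          have hτ0 := hx0.trans hτ.1
          obtain ⟨-, -, -, h3, h1, h2, -⟩ := hzs hτ
          rw [← mul_sub, max_eq_right (le_of_lt h1), max_eq_right (le_of_lt h2)]
          refine mul_le_mul_of_nonneg_left ?_ (Real.rpow_nonneg hτ0 _)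
          refine (le_abs_self _).trans (h3.trans (mul_le_mul_of_nonneg_left ?_ hL0))
          simp only
          rw [abs_of_nonneg (sub_nonneg.2 (hWuv τ hτ0))]
          exact hDmono τ z hτ0 hτ.2
        rw [intervalIntegral.integral_mul_const] at this
        linarith
      have hθz := (hzs ⟨hxz.le, le_rfl⟩).2.2.2.2.2.2.1
      have hIa0 : 0 ≤ ∫ s in x..z, s ^ (-γ) :=
        intervalIntegral.integral_nonneg hxz.le fun s hs => Real.rpow_nonneg (hx0.trans hs.1) _
      have hfin : u z - v z ≤
          (L * (K * ∫ τ in x..z, τ ^ (d - 1)) * (∫ s in x..z, s ^ (-γ))) * (u z - v z) :=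
        calc u z - v z ≤ (∫ s in x..z, s ^ (-γ)) * (L * (Wv z - Wu z)) := hE_le
          _ ≤ (∫ s in x..z, s ^ (-γ)) * (L * (K * (∫ τ in x..z, τ ^ (d - 1)) * (u z - v z))) := by
            gcongr
          _ = _ := by ring
      show u z = v z
      nlinarith
  have := hflux_eq R hR (hsub ⟨hR, le_rfl⟩)
  have h2 := hWv R hR
  linarith

end IsShootProfile

lemma isShootProfile_shootMax (hγ : γ < 1) (hκ : 0 < κ) (hq : 0 < q) :
    IsShootProfile d γ κ q m (shootMax d γ κ q m) :=
  ⟨measurable_shootMax hγ hκ hq, fun _ hr => shootMax_eq hγ hκ hq hr⟩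

lemma IsShootProfile.of_tendsto (hγ : γ < 1) (hκ : 0 < κ) (hq : 0 < q) {mk : ℕ → ℝ}
    {uk : ℕ → ℝ → ℝ} (huk : ∀ k, IsShootProfile d γ κ q (mk k) (uk k))
    (hm : Tendsto mk atTop (𝓝 m)) (hu : Measurable u)
    (hlim : ∀ r, 0 ≤ r → Tendsto (fun k => uk k r) atTop (𝓝 (u r))) :
    IsShootProfile d γ κ q m u := by
  refine ⟨hu, fun r hr => tendsto_nhds_unique (hlim r hr) ?_⟩
  refine (tendsto_shootMap hγ hκ hq (fun k => (huk k).measurable) hm hlim hr).congr fun k => ?_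
  exact ((huk k).eq_shootMap r hr).symm

/-- With `m = 0` the constant `1` is a fixed point, so the greatest profile lies above it and
consumes flux immediately. -/
lemma exists_flux_neg_shootMax_zero (hγ : γ < 1) (hκ : 0 < κ) (hq : 0 < q) :
    ∃ r, 0 ≤ r ∧ shootFlux d q 0 (shootMax d γ κ q 0) r < 0 := by
  have hone : ∀ r, 0 ≤ r → 1 ≤ shootMax d γ κ q 0 r := by
    intro r hr
    refine le_shootMax (v := fun _ => 1) hγ hκ hq measurable_const (fun s hs => le_of_eq ?_) hr
    have : ∫ t in (0 : ℝ)..s, t ^ (-γ) * (max 0 (shootFlux d q 0 (fun _ => 1) t)) ^ κ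
        = ∫ t in (0 : ℝ)..s, (0 : ℝ) := by
      refine intervalIntegral.integral_congr fun t ht => ?_
      rw [uIcc_of_le hs] at ht
      have : max 0 (shootFlux d q 0 (fun _ => 1) t) = 0 :=
        max_eq_left (shootFlux_le hq measurable_const ht.1)
      simp [this, Real.zero_rpow hκ.ne']
    simp [shootMap, this]
  refine ⟨1, zero_le_one, (shootFlux_mono hq measurable_const (measurable_shootMax hγ hκ hq) le_rfl
    hone zero_le_one).trans_lt ?_⟩
  have : clampPow q 1 = 1 := by simp [clampPow]
  simp only [shootFlux, this, mul_one, integral_pow, one_pow]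
  rw [zero_pow (Nat.succ_ne_zero _)]
  have : (0 : ℝ) < 1 / (((d - 1 : ℕ) : ℝ) + 1) := by positivity
  simpa using this

/-- On `[0, 1]` at most one unit of flux is consumed, so at least `1` remains. As `s^(-γ) ≥ 1`
there, the profile falls at rate at least `1` and is nonpositive at `1`; from then on the flux is
frozen. -/
lemma IsShootProfile.flux_nonneg_of_two_le (hu : IsShootProfile d γ κ q m u) (hγ0 : 0 ≤ γ)
    (hγ : γ < 1) (hκ : 0 < κ) (hq : 0 < q) (hm : 2 ≤ m) {r : ℝ} (hr : 0 ≤ r) :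
    0 ≤ shootFlux d q m u r := by
  have hanti := shootFlux_antitoneOn (d := d) (m := m) hq hu.measurable
  have h1 : 1 ≤ shootFlux d q m u 1 := by
    have : ∫ τ in (0 : ℝ)..1, τ ^ (d - 1) * clampPow q (u τ) ≤ ∫ τ in (0 : ℝ)..1, (1 : ℝ) := by
      refine intervalIntegral.integral_mono_on zero_le_one
        (intervalIntegrable_source hq hu.measurable 0 1) intervalIntegrable_const fun τ hτ => ?_
      exact mul_le_one₀ (pow_le_one₀ hτ.1 hτ.2) (clampPow_nonneg _) (clampPow_le_one hq _)
    simp only [intervalIntegral.integral_const, sub_zero, smul_eq_mul, mul_one] at this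
    rw [shootFlux]
    linarith
  have hu1 : u 1 ≤ 0 := by
    have h := hu.eq_shootMap 1 zero_le_one
    have : ∫ s in (0 : ℝ)..1, (1 : ℝ)
        ≤ ∫ s in (0 : ℝ)..1, s ^ (-γ) * (max 0 (shootFlux d q m u s)) ^ κ := by
      refine intervalIntegral.integral_mono_on_of_le_Ioo zero_le_one intervalIntegrable_const
        (intervalIntegrable_slope hγ hκ hq hu.measurable 0 1) fun s hs => ?_
      have hs1 := hanti (mem_Ici.2 hs.1.le) (mem_Ici.2 zero_le_one) hs.2.le
      exact one_le_mul_of_one_le_of_one_le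
        (Real.one_le_rpow_of_pos_of_le_one_of_nonpos hs.1 hs.2.le (by linarith))
        (Real.one_le_rpow ((h1.trans hs1).trans (le_max_right _ _)) hκ.le)
    simp only [intervalIntegral.integral_const, sub_zero, smul_eq_mul, mul_one] at this
    rw [shootMap] at h
    linarith
  rcases le_total r 1 with h | h
  · linarith [hanti (mem_Ici.2 hr) (mem_Ici.2 zero_le_one) h]
  · rw [shootFlux_eq_of_nonpos hq hu.measurable h fun τ hτ =>
      (hu.antitoneOn hγ hκ hq (mem_Ici.2 zero_le_one) (mem_Ici.2 (zero_le_one.trans hτ.1))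
        hτ.1).trans hu1]
    linarith

/-- For a suitable initial flux the shooting problem has a global nonnegative profile with
nonnegative flux. -/
theorem exists_shootProfile_nonneg (d : ℕ) (hγ0 : 0 ≤ γ) (hγ : γ < 1) (hκ : 0 < κ) (hq : 0 < q) :
    ∃ (m : ℝ) (u : ℝ → ℝ), IsShootProfile d γ κ q m u ∧
      ∀ r, 0 ≤ r → 0 ≤ u r ∧ 0 ≤ shootFlux d q m u r := by
  set U : ℝ → ℝ → ℝ := fun m => shootMax d γ κ q m with hU
  have hP : ∀ m, IsShootProfile d γ κ q m (U m) := fun m => isShootProfile_shootMax hγ hκ hq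
  set A : Set ℝ := {m | ∃ r, 0 ≤ r ∧ shootFlux d q m (U m) r < 0} with hA
  have hdown : ∀ m ∈ A, ∀ m' ≤ m, m' ∈ A := by
    rintro m ⟨r, hr, hW⟩ m' hm'
    exact ⟨r, hr, (shootFlux_mono hq (hP m).measurable (hP m').measurable hm'
      (fun s hs => shootMax_anti hγ hκ hq hm' hs) hr).trans_lt hW⟩
  have hne : A.Nonempty := ⟨0, exists_flux_neg_shootMax_zero hγ hκ hq⟩
  have hbdd : BddAbove A := by
    refine ⟨2, fun m ⟨r, hr, hW⟩ => ?_⟩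
    by_contra! hm
    exact absurd ((hP m).flux_nonneg_of_two_le hγ0 hγ hκ hq hm.le hr) (not_le.2 hW)
  set M := sSup A with hM
  have hε : Tendsto (fun k : ℕ => 1 / ((k : ℝ) + 1)) atTop (𝓝 0) :=
    tendsto_one_div_add_atTop_nhds_zero_nat
  have hεanti : Antitone fun k : ℕ => 1 / ((k : ℝ) + 1) := fun i j h =>
    one_div_le_one_div_of_le (by positivity) (by exact_mod_cast Nat.succ_le_succ h)
  have hεpos : ∀ k : ℕ, 0 < 1 / ((k : ℝ) + 1) := fun k => by positivity
  -- If `M ∈ A`, the limit `v` of greatest profiles from above has nonnegative flux, as those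
  -- parameters lie outside `A`; but `v` is a profile below `U M`, so its flux must become negative.
  by_cases hMA : M ∈ A
  · exfalso
    set v : ℝ → ℝ := fun r => ⨆ k : ℕ, U (M + 1 / ((k : ℝ) + 1)) r with hv
    have hlim : ∀ r, 0 ≤ r → Tendsto (fun k : ℕ => U (M + 1 / ((k : ℝ) + 1)) r) atTop
        (𝓝 (v r)) := fun r hr => by
      refine tendsto_atTop_ciSup (fun i j h => shootMax_anti hγ hκ hq ?_ hr) ⟨1, ?_⟩
      · exact add_le_add le_rfl (hεanti h)
      · rintro _ ⟨k, rfl⟩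
        exact (hP _).le_one hγ hκ hq hr
    have hmlim : Tendsto (fun k : ℕ => M + 1 / ((k : ℝ) + 1)) atTop (𝓝 M) := by
      simpa using hε.const_add M
    have hvP : IsShootProfile d γ κ q M v :=
      .of_tendsto hγ hκ hq (fun k => hP _) hmlim (Measurable.iSup fun k => (hP _).measurable) hlim
    have hvle : ∀ r, 0 ≤ r → v r ≤ U M r := fun r hr =>
      le_shootMax hγ hκ hq hvP.measurable (fun s hs => (hvP.eq_shootMap s hs).le) hr
    obtain ⟨R, hR, hWR⟩ := hMA
    obtain ⟨r, hr, hWr⟩ := (hP M).exists_flux_neg hvP hγ hκ hq hvle hR hWR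
    refine absurd (ge_of_tendsto' (tendsto_shootFlux hq (fun k => (hP _).measurable) hmlim hlim hr)
      fun k => ?_) (not_le.2 hWr)
    by_contra! hneg
    have : M + 1 / ((k : ℝ) + 1) ≤ M := le_csSup hbdd ⟨r, hr, hneg⟩
    linarith [hεpos k]
  · refine ⟨M, U M, hP M, fun r hr => ⟨?_, by_contra fun h => hMA ⟨r, hr, not_le.1 h⟩⟩⟩
    have hmem : ∀ k : ℕ, M - 1 / ((k : ℝ) + 1) ∈ A := fun k => by
      obtain ⟨a, haA, ha⟩ := exists_lt_of_lt_csSup hne (sub_lt_self M (hεpos k))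
      exact hdown a haA _ ha.le
    have hnn : ∀ (k : ℕ) r, 0 ≤ r → 0 ≤ U (M - 1 / ((k : ℝ) + 1)) r := fun k r hr => by
      obtain ⟨R, hR, hWR⟩ := hmem k
      exact (hP _).nonneg_of_flux_neg hγ hκ hq hR hWR hr
    -- Parameters below `M` lie in `A`, so their profiles are nonnegative; so is their limit, and `U
    -- M` dominates it.
    set v : ℝ → ℝ := fun r => ⨅ k : ℕ, U (M - 1 / ((k : ℝ) + 1)) r with hv
    have hlim : ∀ r, 0 ≤ r → Tendsto (fun k : ℕ => U (M - 1 / ((k : ℝ) + 1)) r) atTop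
        (𝓝 (v r)) := fun r hr => by
      refine tendsto_atTop_ciInf (fun i j h => shootMax_anti hγ hκ hq ?_ hr) ⟨0, ?_⟩
      · exact sub_le_sub le_rfl (hεanti h)
      · rintro _ ⟨k, rfl⟩
        exact hnn k r hr
    have hmlim : Tendsto (fun k : ℕ => M - 1 / ((k : ℝ) + 1)) atTop (𝓝 M) := by
      simpa using hε.const_sub M
    have hvP : IsShootProfile d γ κ q M v :=
      .of_tendsto hγ hκ hq (fun k => hP _) hmlim (Measurable.iInf fun k => (hP _).measurable) hlim
    exact (ge_of_tendsto' (hlim r hr) fun k => hnn k r hr).trans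
      (le_shootMax hγ hκ hq hvP.measurable (fun s hs => (hvP.eq_shootMap s hs).le) hr)

end ShootingExistence

/-! ### From a shooting profile to a solution of the radial problem. -/

section Profile

variable {d : ℕ} {γ κ q m p : ℝ} {u v : ℝ → ℝ}

lemma abs_rpow_sub_two_mul_self (x : ℝ) (hp : 1 < p) : |x| ^ (p - 2) * |x| = |x| ^ (p - 1) := by
  rcases eq_or_ne x 0 with rfl | hx
  · simp [Real.zero_rpow (show p - 1 ≠ 0 by linarith)]
  · rw [← Real.rpow_add_one (abs_ne_zero.2 hx)]
    congr 1; ring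

lemma pFlux_eq_of_deriv_nonpos (hp : 1 < p) {r : ℝ} (h : deriv u r ≤ 0) :
    pFlux p u r = -|deriv u r| ^ (p - 1) := by
  rw [pFlux, ← abs_rpow_sub_two_mul_self _ hp, abs_of_nonpos h]
  ring

namespace IsShootProfile

lemma continuousAt (hu : IsShootProfile d γ κ q m u) (hγ : γ < 1) (hκ : 0 < κ) (hq : 0 < q)
    {r : ℝ} (hr : 0 < r) : ContinuousAt u r :=
  (hu.continuousOn hγ hκ hq).continuousAt (Ici_mem_nhds hr)

lemma hasDerivAt (hu : IsShootProfile d γ κ q m u) (hγ : γ < 1) (hκ : 0 < κ) (hq : 0 < q)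
    {r : ℝ} (hr : 0 < r) :
    HasDerivAt u (-(r ^ (-γ) * (max 0 (shootFlux d q m u r)) ^ κ)) r := by
  have hc := continuous_fluxPow (d := d) (m := m) hκ hq hu.measurable
  have h : HasDerivAt (shootMap d γ κ q m u)
      (-(r ^ (-γ) * (max 0 (shootFlux d q m u r)) ^ κ)) r := by
    refine (intervalIntegral.integral_hasDerivAt_right
      (intervalIntegrable_slope hγ hκ hq hu.measurable 0 r) ?_ ?_).const_sub 1
    · exact ((measurable_id.pow_const _).mul hc.measurable).stronglyMeasurable.stronglyMeasurableAtFilter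
    · exact (Real.continuousAt_rpow_const _ _ (Or.inl hr.ne')).mul hc.continuousAt
  refine h.congr_of_eventuallyEq ?_
  filter_upwards [lt_mem_nhds hr] with s hs using hu.eq_shootMap s hs.le

lemma hasDerivAt_flux (hu : IsShootProfile d γ κ q m u) (hγ : γ < 1) (hκ : 0 < κ) (hq : 0 < q)
    {r : ℝ} (hr : 0 < r) :
    HasDerivAt (shootFlux d q m u) (-(r ^ (d - 1) * clampPow q (u r))) r := by
  refine (intervalIntegral.integral_hasDerivAt_right
    (intervalIntegrable_source hq hu.measurable 0 r)
    (measurable_source hq hu.measurable).stronglyMeasurable.stronglyMeasurableAtFilter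
    ?_).const_sub m
  exact (continuous_pow (d - 1)).continuousAt.mul
    ((continuous_clampPow hq).continuousAt.comp (hu.continuousAt hγ hκ hq hr))

lemma contDiffOn (hu : IsShootProfile d γ κ q m u) (hγ : γ < 1) (hκ : 0 < κ) (hq : 0 < q) :
    ContDiffOn ℝ 1 u (Ioi 0) := by
  rw [show (1 : WithTop ℕ∞) = 0 + 1 by simp, contDiffOn_succ_iff_deriv_of_isOpen isOpen_Ioi]
  refine ⟨fun r hr => (hu.hasDerivAt hγ hκ hq hr).differentiableAt.differentiableWithinAt,
    by simp, ?_⟩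
  rw [contDiffOn_zero]
  have hc : ContinuousOn (fun r : ℝ => -(r ^ (-γ) * (max 0 (shootFlux d q m u r)) ^ κ)) (Ioi 0) :=
    ((continuousOn_id.rpow_const fun r hr => Or.inl (ne_of_gt hr)).mul
      (continuous_fluxPow hκ hq hu.measurable).continuousOn).neg
  exact hc.congr fun r hr => (hu.hasDerivAt hγ hκ hq hr).deriv

/-- A positive lower bound on `u` would drain the flux at least linearly on `[1, ∞)`, making it
negative. -/
lemma tendsto_atTop_zero (hu : IsShootProfile d γ κ q m u) (hγ : γ < 1) (hκ : 0 < κ) (hq : 0 < q)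
    (h0 : ∀ r, 0 ≤ r → 0 ≤ u r) (hW : ∀ r, 0 ≤ r → 0 ≤ shootFlux d q m u r) :
    Tendsto u atTop (𝓝 0) := by
  have key : ∀ ε > 0, ∃ R, 0 ≤ R ∧ u R < ε := by
    intro ε hε
    by_contra! hge
    have hc : 0 < clampPow q ε :=
      Real.rpow_pos_of_pos (lt_max_of_lt_right (lt_min hε one_pos)) _
    set c := clampPow q ε
    -- Chosen so that the consumption `(R - 1) * c` over `[1, R]` exceeds the flux at `1` by `c`.
    set R := 2 + shootFlux d q m u 1 / c
    have hR : 1 ≤ R := by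
      have : 0 ≤ shootFlux d q m u 1 / c := div_nonneg (hW 1 zero_le_one) hc.le
      linarith
    have h1 := shootFlux_sub (d := d) (m := m) hq hu.measurable 1 R
    have h2 : ∫ τ in (1 : ℝ)..R, c ≤ ∫ τ in (1 : ℝ)..R, τ ^ (d - 1) * clampPow q (u τ) := by
      refine intervalIntegral.integral_mono_on hR intervalIntegrable_const
        (intervalIntegrable_source hq hu.measurable 1 R) fun τ hτ => ?_
      have h3 : c ≤ clampPow q (u τ) := clampPow_mono hq (hge τ (zero_le_one.trans hτ.1))
      exact h3.trans (le_mul_of_one_le_left (clampPow_nonneg _) (one_le_pow₀ hτ.1))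
    rw [intervalIntegral.integral_const, smul_eq_mul] at h2
    have h4 : (R - 1) * c = c + shootFlux d q m u 1 := by
      simp only [R]; field_simp; ring
    linarith [hW R (zero_le_one.trans hR)]
  rw [Metric.tendsto_atTop]
  intro ε hε
  obtain ⟨R, hR, hRε⟩ := key ε hε
  refine ⟨R, fun r hr => ?_⟩
  have hr0 := hR.trans hr
  rw [Real.dist_eq, sub_zero, abs_of_nonneg (h0 r hr0)]
  exact (hu.antitoneOn hγ hκ hq hR hr0 hr).trans_lt hRε

end IsShootProfile

theorem exists_isC1NonincreasingSolution (hd : 1 ≤ d) (hp : (d : ℝ) < p) (hq : 0 < q) :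
    ∃ u : ℝ → ℝ, IsC1NonincreasingSolution d p q u := by
  have hd1 : (1 : ℝ) ≤ d := by exact_mod_cast hd
  have hp1 : 0 < p - 1 := by linarith
  have hγ0 : 0 ≤ ((d : ℝ) - 1) / (p - 1) := div_nonneg (by linarith) hp1.le
  have hγ : ((d : ℝ) - 1) / (p - 1) < 1 := (div_lt_one hp1).2 (by linarith)
  have hκ : 0 < 1 / (p - 1) := by positivity
  obtain ⟨m, u, hu, huW⟩ := exists_shootProfile_nonneg d hγ0 hγ hκ hq
  have hW0 := fun r hr => (huW r hr).2
  -- Raising the slope to the power `p - 1` undoes `κ` and turns `r^(-γ)` into `r^(-(d-1))`.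
  have hflux : ∀ r ∈ Ioi (0 : ℝ), r ^ (d - 1) * pFlux p u r = -shootFlux d q m u r := by
    intro r hr
    have hr : 0 < r := hr
    have hder := (hu.hasDerivAt hγ hκ hq hr).deriv
    rw [max_eq_right (hW0 r hr.le)] at hder
    have hx : 0 ≤ r ^ (-(((d : ℝ) - 1) / (p - 1))) * shootFlux d q m u r ^ (1 / (p - 1)) :=
      mul_nonneg (Real.rpow_nonneg hr.le _) (Real.rpow_nonneg (hW0 r hr.le) _)
    rw [pFlux_eq_of_deriv_nonpos (by linarith) (by rw [hder]; linarith), hder, abs_neg,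
      abs_of_nonneg hx, Real.mul_rpow (Real.rpow_nonneg hr.le _)
      (Real.rpow_nonneg (hW0 r hr.le) _), ← Real.rpow_mul hr.le, ← Real.rpow_mul (hW0 r hr.le),
      one_div_mul_cancel hp1.ne', Real.rpow_one, neg_mul, div_mul_cancel₀ _ hp1.ne',
      Real.rpow_neg hr.le, ← Real.rpow_natCast, Nat.cast_sub hd, Nat.cast_one]
    have : r ^ ((d : ℝ) - 1) ≠ 0 := (Real.rpow_pos_of_pos hr _).ne'
    field_simp
  refine ⟨u, hu.contDiffOn hγ hκ hq, (hu.antitoneOn hγ hκ hq).mono Ioi_subset_Ici_self, ?_, ?_,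
    hu.tendsto_atTop_zero hγ hκ hq (fun r hr => (huW r hr).1) hW0⟩
  · intro φ hφ hφc hφs
    have hcW := continuous_shootFlux (d := d) (m := m) hq hu.measurable
    have hφ' : Continuous (deriv φ) := hφ.continuous_deriv le_rfl
    have hI1 : Integrable fun r => deriv φ r * shootFlux d q m u r :=
      (hφ'.mul hcW).integrable_of_hasCompactSupport hφc.deriv.mul_right
    have hI2 : Integrable fun r => φ r * (r ^ (d - 1) * clampPow q (u r)) := by
      have hb : Integrable fun r => φ r * r ^ (d - 1) :=
        (hφ.continuous.mul (continuous_pow _)).integrable_of_hasCompactSupport hφc.mul_right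
      refine hb.mono (hφ.continuous.measurable.mul
        (measurable_source hq hu.measurable)).aestronglyMeasurable (ae_of_all _ fun r => ?_)
      rw [norm_mul (φ r), norm_mul (φ r)]
      exact mul_le_mul_of_nonneg_left (norm_source_le hq _ _) (norm_nonneg (φ r))
    have hφ0 : φ 0 = 0 := image_eq_zero_of_notMem_tsupport fun h => lt_irrefl (0 : ℝ) (hφs h)
    have hparts := integral_Ioi_of_hasDerivAt_of_tendsto (a := 0) (m := 0)
      (f := fun r => φ r * shootFlux d q m u r)
      (f' := fun r => deriv φ r * shootFlux d q m u r - φ r * (r ^ (d - 1) * clampPow q (u r)))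
      (hφ.continuous.mul hcW).continuousWithinAt
      (fun r hr => by
        have h := (hφ.differentiable one_ne_zero r).hasDerivAt.mul (hu.hasDerivAt_flux hγ hκ hq hr)
        rwa [mul_neg, ← sub_eq_add_neg] at h)
      (hI1.sub hI2).integrableOn
      ((hφc.mul_right (f' := shootFlux d q m u)).is_zero_at_infty.mono_left atTop_le_cocompact)
    rw [integral_sub hI1.integrableOn hI2.integrableOn, hφ0] at hparts
    have h1 : ∫ r in Ioi (0 : ℝ), deriv φ r * (r ^ (d - 1) * pFlux p u r)
        = ∫ r in Ioi (0 : ℝ), -(deriv φ r * shootFlux d q m u r) :=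
      setIntegral_congr_fun measurableSet_Ioi fun r hr => by
        rw [hflux r hr]; ring
    have h2 : ∫ r in Ioi (0 : ℝ), φ r * (r ^ (d - 1) * u r ^ q)
        = ∫ r in Ioi (0 : ℝ), φ r * (r ^ (d - 1) * clampPow q (u r)) :=
      setIntegral_congr_fun measurableSet_Ioi fun r hr => by
        have hr : 0 < r := hr
        rw [clampPow_of_mem (huW r hr.le).1 (hu.le_one hγ hκ hq hr.le)]
    rw [h1, h2, integral_neg]
    linarith
  · have h := (hu.continuousOn hγ hκ hq) 0 self_mem_Ici
    have h0 : u 0 = 1 := by rw [hu.eq_shootMap 0 le_rfl, shootMap_zero]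
    rw [ContinuousWithinAt, h0] at h
    exact h.mono_left (nhdsWithin_mono _ Ioi_subset_Ici_self)

end Profile

/-! ### Du Bois-Reymond and integration over the half-line. -/

section WeakToStrong

lemma integrable_mul_of_tsupport_subset {ψ h : ℝ → ℝ} {U : Set ℝ} (hU : IsOpen U)
    (hψ : Continuous ψ) (hψc : HasCompactSupport ψ) (hψs : tsupport ψ ⊆ U)
    (hh : ContinuousOn h U) :
    Continuous (fun x => ψ x * h x) ∧ Integrable (fun x => ψ x * h x) := by
  have hc : Continuous fun x => ψ x * h x :=
    (hψ.continuousOn.mul hh).continuous_of_tsupport_subset hU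
      ((tsupport_mul_subset_left (f := ψ) (g := h)).trans hψs)
  exact ⟨hc, hc.integrable_of_hasCompactSupport hψc.mul_right⟩

/-- A continuous function with compact support in `(0, ∞)` and vanishing integral is the
derivative of a `C¹` function with compact support in `(0, ∞)`. -/
lemma exists_primitive_of_integral_eq_zero {θ : ℝ → ℝ} (hθ : Continuous θ)
    (hθc : HasCompactSupport θ) (hθs : tsupport θ ⊆ Ioi 0) (hθ0 : ∫ x, θ x = 0) :
    ∃ φ : ℝ → ℝ, ContDiff ℝ 1 φ ∧ HasCompactSupport φ ∧ tsupport φ ⊆ Ioi 0 ∧ deriv φ = θ := by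
  obtain ⟨a, ha, b, hab⟩ : ∃ a > 0, ∃ b, tsupport θ ⊆ Icc a b := by
    rcases (tsupport θ).eq_empty_or_nonempty with he | hne
    · exact ⟨1, one_pos, 1, by simp [he]⟩
    · obtain ⟨x, hx, hmin⟩ := hθc.isCompact.exists_isMinOn hne continuousOn_id
      obtain ⟨b, hb⟩ := hθc.isCompact.bddAbove
      exact ⟨x, hθs hx, b, fun y hy => ⟨hmin hy, hb hy⟩⟩
  have hout : ∀ x, x ∉ Icc a b → θ x = 0 := fun x hx =>
    image_eq_zero_of_notMem_tsupport fun h => hx (hab h)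
  set φ : ℝ → ℝ := fun x => ∫ t in (0 : ℝ)..x, θ t with hφ
  have hder : ∀ x, HasDerivAt φ (θ x) x := fun x => hθ.integral_hasStrictDerivAt 0 x |>.hasDerivAt
  have hderiv : deriv φ = θ := funext fun x => (hder x).deriv
  have hsupp : Function.support φ ⊆ Icc a b := by
    refine Function.support_subset_iff'.2 fun x hx => ?_
    rcases lt_or_ge x a with hxa | hxa
    · refine (intervalIntegral.integral_congr (g := fun _ => 0) fun t ht => ?_).trans (by simp)
      refine hout t fun h => ?_
      have : t ≤ max 0 x := ht.2
      rcases le_max_iff.1 this with h' | h' <;> linarith [h.1]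
    · have hxb : b < x := lt_of_not_ge fun h => hx ⟨hxa, h⟩
      rw [← hθ0]
      refine intervalIntegral.integral_eq_integral_of_support_subset fun t ht => ?_
      have := hab (subset_tsupport θ ht)
      exact ⟨ha.trans_le this.1, this.2.trans hxb.le⟩
  have hts : tsupport φ ⊆ Icc a b := closure_minimal hsupp isClosed_Icc
  refine ⟨φ, contDiff_one_iff_deriv.2 ⟨fun x => (hder x).differentiableAt, hderiv ▸ hθ⟩,
    HasCompactSupport.of_support_subset_isCompact isCompact_Icc hsupp,
    hts.trans fun x hx => ha.trans_le hx.1, hderiv⟩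

/-- The lemma of du Bois-Reymond on `(0, ∞)`. -/
lemma exists_eqOn_const_of_integral_deriv_mul_eq_zero {h : ℝ → ℝ} (hh : ContinuousOn h (Ioi 0))
    (H : ∀ φ : ℝ → ℝ, ContDiff ℝ 1 φ → HasCompactSupport φ → tsupport φ ⊆ Ioi 0 →
      ∫ r in Ioi (0 : ℝ), deriv φ r * h r = 0) :
    ∃ c, EqOn h (fun _ => c) (Ioi 0) := by
  let f : ContDiffBump (1 : ℝ) := ⟨1 / 4, 1 / 2, by norm_num, by norm_num⟩
  set η := f.normed volume with hη
  have hηc : Continuous η := f.continuous_normed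
  have hηs : tsupport η ⊆ Ioi 0 := by
    rw [hη, f.tsupport_normed_eq, Real.closedBall_eq_Icc]
    intro x hx
    have : (1 : ℝ) - 1 / 2 ≤ x := hx.1
    exact mem_Ioi.2 (by linarith)
  have hηcs : HasCompactSupport η := f.hasCompactSupport_normed
  have hη1 : ∫ x, η x = 1 := f.integral_normed
  have hηi : Integrable η := hηc.integrable_of_hasCompactSupport hηcs
  obtain ⟨-, hηhi⟩ := integrable_mul_of_tsupport_subset isOpen_Ioi hηc hηcs hηs hh
  have hset : ∀ g k : ℝ → ℝ, tsupport g ⊆ Ioi 0 →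
      ∫ x in Ioi (0 : ℝ), g x * k x = ∫ x, g x * k x := fun g k hg =>
    setIntegral_eq_integral_of_forall_compl_eq_zero fun x hx => by
      rw [image_eq_zero_of_notMem_tsupport fun h => hx (hg h), zero_mul]
  refine ⟨∫ x, η x * h x, ?_⟩
  set c := ∫ x, η x * h x with hc
  have hae : ∀ᵐ x, x ∈ Ioi (0 : ℝ) → h x - c = 0 := by
    refine isOpen_Ioi.ae_eq_zero_of_integral_contDiff_smul_eq_zero
      ((hh.sub continuousOn_const).locallyIntegrableOn measurableSet_Ioi) fun ψ hψ hψcs hψs => ?_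
    have hψc := hψ.continuous
    have hψi : Integrable ψ := hψc.integrable_of_hasCompactSupport hψcs
    obtain ⟨-, hψhi⟩ := integrable_mul_of_tsupport_subset isOpen_Ioi hψc hψcs hψs hh
    set I := ∫ x, ψ x with hI
    -- Subtracting a multiple of the unit-mass bump `η` makes the integral vanish, so `θ` is the
    -- derivative of an admissible test function.
    set θ : ℝ → ℝ := fun x => ψ x - I * η x with hθ
    have hsub : Function.support θ ⊆ tsupport ψ ∪ tsupport η := by
      refine Function.support_subset_iff'.2 fun x hx => ?_
      rw [mem_union, not_or] at hx
      simp [hθ, image_eq_zero_of_notMem_tsupport hx.1, image_eq_zero_of_notMem_tsupport hx.2]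
    have hcomp : IsCompact (tsupport ψ ∪ tsupport η) := hψcs.isCompact.union hηcs.isCompact
    have hθs : tsupport θ ⊆ Ioi 0 :=
      (closure_minimal hsub hcomp.isClosed).trans (union_subset hψs hηs)
    obtain ⟨φ, h1, h2, h3, h4⟩ := exists_primitive_of_integral_eq_zero (θ := θ)
      (hψc.sub (continuous_const.mul hηc))
      (HasCompactSupport.of_support_subset_isCompact hcomp hsub) hθs (by
        rw [hθ, integral_sub hψi (hηi.const_mul I), integral_const_mul, hη1, mul_one, sub_self])
    have h5 := H φ h1 h2 h3
    rw [h4, hset θ h hθs] at h5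
    have h6 : ∫ x, θ x * h x = ∫ x, (ψ x * h x - I * (η x * h x)) := by
      congr 1; ext x; simp only [hθ]; ring
    rw [h6, integral_sub hψhi (hηhi.const_mul I), integral_const_mul, ← hc] at h5
    have h7 : ∫ x, ψ x • (h x - c) = ∫ x, (ψ x * h x - ψ x * c) := by
      congr 1; ext x; simp only [smul_eq_mul]; ring
    rw [h7, integral_sub hψhi (hψi.mul_const c), integral_mul_const, ← hI]
    exact h5
  refine Measure.eqOn_open_of_ae_eq (μ := volume) ?_ isOpen_Ioi hh continuousOn_const
  rw [Filter.EventuallyEq, ae_restrict_iff' measurableSet_Ioi]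
  filter_upwards [hae] with x hx hx0 using sub_eq_zero.1 (hx hx0)

/-- The fundamental theorem of calculus on `(0, ∞)` for a decreasing function with limits at both
ends. -/
lemma integral_Ioi_of_hasDerivAt_of_nonpos_of_tendsto {F F' : ℝ → ℝ} {ℓ L : ℝ}
    (hder : ∀ x ∈ Ioi (0 : ℝ), HasDerivAt F (F' x) x) (hneg : ∀ x ∈ Ioi (0 : ℝ), F' x ≤ 0)
    (h0 : Tendsto F (𝓝[>] 0) (𝓝 ℓ)) (hL : Tendsto F atTop (𝓝 L)) :
    IntegrableOn F' (Ioi 0) ∧ ∫ x in Ioi (0 : ℝ), F' x = L - ℓ := by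
  -- Only the right limit of `F` at `0` is known; resetting its value there gives one-sided
  -- continuity.
  set E := Function.update F 0 ℓ with hE
  have hEF : ∀ x : ℝ, 0 < x → E x = F x := fun x hx => Function.update_of_ne hx.ne' _ _
  have hcont : ContinuousWithinAt E (Ici 0) 0 := by
    rw [hE, continuousWithinAt_update_same, Ici_sdiff_left]
    exact h0
  have hEder : ∀ x ∈ Ioi (0 : ℝ), HasDerivAt E (F' x) x := fun x hx =>
    (hder x hx).congr_of_eventuallyEq ((lt_mem_nhds hx).mono fun y hy => hEF y hy)
  have hEL : Tendsto E atTop (𝓝 L) :=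
    hL.congr' ((eventually_gt_atTop 0).mono fun y hy => (hEF y hy).symm)
  have hint := integrableOn_Ioi_deriv_of_nonpos hcont hEder hneg hEL
  refine ⟨hint, ?_⟩
  rw [integral_Ioi_of_hasDerivAt_of_tendsto hcont hEder hint hEL, hE, Function.update_self]

end WeakToStrong

/-! ### Properties of an arbitrary solution. -/

namespace IsC1NonincreasingSolution

variable {d : ℕ} {p q : ℝ} {u : ℝ → ℝ}

lemma nonneg (hu : IsC1NonincreasingSolution d p q u) {r : ℝ} (hr : 0 < r) : 0 ≤ u r :=
  le_of_tendsto hu.tendsto_atTop ((eventually_ge_atTop r).mono fun _ hs =>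
    hu.antitoneOn hr (mem_Ioi.2 (hr.trans_le hs)) hs)

lemma le_one (hu : IsC1NonincreasingSolution d p q u) {r : ℝ} (hr : 0 < r) : u r ≤ 1 := by
  refine ge_of_tendsto hu.tendsto_zero ?_
  filter_upwards [Ioc_mem_nhdsGT hr] with s hs using hu.antitoneOn hs.1 hr hs.2

lemma hasDerivAt (hu : IsC1NonincreasingSolution d p q u) {r : ℝ} (hr : 0 < r) :
    HasDerivAt u (deriv u r) r :=
  ((hu.contDiffOn.contDiffAt (Ioi_mem_nhds hr)).differentiableAt one_ne_zero).hasDerivAt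

lemma continuousOn_deriv (hu : IsC1NonincreasingSolution d p q u) :
    ContinuousOn (deriv u) (Ioi 0) :=
  hu.contDiffOn.continuousOn_deriv_of_isOpen isOpen_Ioi le_rfl

lemma deriv_nonpos (hu : IsC1NonincreasingSolution d p q u) {r : ℝ} (hr : 0 < r) :
    deriv u r ≤ 0 := by
  rw [← derivWithin_of_isOpen isOpen_Ioi hr]
  exact hu.antitoneOn.derivWithin_nonpos

lemma continuousOn_source (hu : IsC1NonincreasingSolution d p q u) (hq : 0 < q) :
    ContinuousOn (fun r : ℝ => r ^ (d - 1) * u r ^ q) (Ioi 0) :=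
  (continuous_pow _).continuousOn.mul
    (hu.contDiffOn.continuousOn.rpow_const fun _ _ => Or.inr hq.le)

lemma source_nonneg (hu : IsC1NonincreasingSolution d p q u) {r : ℝ} (hr : 0 < r) :
    0 ≤ r ^ (d - 1) * u r ^ q :=
  mul_nonneg (pow_nonneg hr.le _) (Real.rpow_nonneg (hu.nonneg hr) _)

lemma pFlux_eq (hu : IsC1NonincreasingSolution d p q u) (hp : 1 < p) {r : ℝ} (hr : 0 < r) :
    pFlux p u r = -|deriv u r| ^ (p - 1) :=
  pFlux_eq_of_deriv_nonpos hp (hu.deriv_nonpos hr)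

/-- The weighted flux is differentiable, with the derivative prescribed by the equation. -/
lemma hasDerivAt_flux (hu : IsC1NonincreasingSolution d p q u) (hp : 1 < p) (hq : 0 < q) {r : ℝ}
    (hr : 0 < r) :
    HasDerivAt (fun s : ℝ => s ^ (d - 1) * |deriv u s| ^ (p - 1)) (-(r ^ (d - 1) * u r ^ q)) r := by
  set G : ℝ → ℝ := fun r => r ^ (d - 1) * u r ^ q with hG
  set W : ℝ → ℝ := fun s => s ^ (d - 1) * |deriv u s| ^ (p - 1) with hW
  set P : ℝ → ℝ := fun r => ∫ s in (1 : ℝ)..r, G s with hP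
  have hGc : ContinuousOn G (Ioi 0) := hu.continuousOn_source hq
  have hWc : ContinuousOn W (Ioi 0) := (continuous_pow _).continuousOn.mul
    (hu.continuousOn_deriv.abs.rpow_const fun _ _ => Or.inr (by linarith))
  have hPder : ∀ r ∈ Ioi (0 : ℝ), HasDerivAt P (G r) r := fun r hr => by
    have hr : 0 < r := hr
    refine intervalIntegral.integral_hasDerivAt_right ?_
      (hGc.stronglyMeasurableAtFilter isOpen_Ioi r hr) (hGc.continuousAt (Ioi_mem_nhds hr))
    refine (hGc.mono fun s hs => ?_).intervalIntegrable
    exact (lt_min one_pos hr).trans_le hs.1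
  have hPc : ContinuousOn P (Ioi 0) := fun r hr => (hPder r hr).continuousAt.continuousWithinAt
  -- Integrating the source term by parts moves the derivative onto `φ`, so the weak equation says
  -- that `W + P` is orthogonal to every `deriv φ`.
  obtain ⟨c, hc⟩ := exists_eqOn_const_of_integral_deriv_mul_eq_zero
    (h := fun r => W r + P r) (hWc.add hPc)
    fun φ hφ hφc hφs => by
      have hφ' : Continuous (deriv φ) := hφ.continuous_deriv le_rfl
      have hφ's : tsupport (deriv φ) ⊆ Ioi 0 := (tsupport_deriv_subset (𝕜 := ℝ)).trans hφs
      obtain ⟨-, hI1⟩ := integrable_mul_of_tsupport_subset isOpen_Ioi hφ' hφc.deriv hφ's hWc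
      obtain ⟨-, hI2⟩ := integrable_mul_of_tsupport_subset isOpen_Ioi hφ' hφc.deriv hφ's hPc
      obtain ⟨-, hI3⟩ := integrable_mul_of_tsupport_subset isOpen_Ioi hφ.continuous hφc hφs hGc
      obtain ⟨hcP, -⟩ := integrable_mul_of_tsupport_subset isOpen_Ioi hφ.continuous hφc hφs hPc
      have hφ0 : φ 0 = 0 := image_eq_zero_of_notMem_tsupport fun h => lt_irrefl (0 : ℝ) (hφs h)
      have hparts := integral_Ioi_of_hasDerivAt_of_tendsto (a := 0) (m := 0)
        (f := fun r => φ r * P r) (f' := fun r => deriv φ r * P r + φ r * G r)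
        hcP.continuousWithinAt
        (fun r hr => (hφ.differentiable one_ne_zero r).hasDerivAt.mul (hPder r hr))
        (hI2.add hI3).integrableOn
        ((hφc.mul_right (f' := P)).is_zero_at_infty.mono_left atTop_le_cocompact)
      rw [integral_add hI2.integrableOn hI3.integrableOn, hφ0] at hparts
      have heq := hu.equation φ hφ hφc hφs
      have h1 : ∫ r in Ioi (0 : ℝ), deriv φ r * (r ^ (d - 1) * pFlux p u r)
          = ∫ r in Ioi (0 : ℝ), -(deriv φ r * W r) :=
        setIntegral_congr_fun measurableSet_Ioi fun r hr => by
          simp only [hu.pFlux_eq hp hr, hW]; ring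
      rw [h1, integral_neg, neg_neg] at heq
      have h2 : ∫ r in Ioi (0 : ℝ), deriv φ r * (W r + P r)
          = (∫ r in Ioi (0 : ℝ), deriv φ r * W r) + ∫ r in Ioi (0 : ℝ), deriv φ r * P r := by
        rw [← integral_add hI1.integrableOn hI2.integrableOn]
        simp only [mul_add]
      rw [h2, heq]
      linarith
  refine ((hPder r hr).const_sub c).congr_of_eventuallyEq ?_
  filter_upwards [lt_mem_nhds hr] with s hs
  have := hc hs
  simp only at this
  linarith

theorem solvesPointwise (hu : IsC1NonincreasingSolution d p q u) (hd : 1 ≤ d) (hp : 1 < p)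
    (hq : 0 < q) : SolvesPointwise d p q u := by
  intro r hr
  have hpow : HasDerivAt (fun s : ℝ => s ^ (d - 1)) (((d : ℝ) - 1) * r ^ (d - 1) / r) r := by
    refine (hasDerivAt_pow (d - 1) r).congr_deriv ?_
    obtain ⟨n, rfl⟩ : ∃ n, d = n + 1 := ⟨d - 1, by omega⟩
    rcases n with _ | n
    · simp
    · simp only [Nat.add_sub_cancel]
      push_cast
      field_simp
      simp only [add_sub_cancel_right]
      ring
  have hne : r ^ (d - 1) ≠ 0 := (pow_pos hr _).ne'
  have h := ((hu.hasDerivAt_flux hp hq hr).div hpow hne).neg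
  have heq : pFlux p u =ᶠ[𝓝 r]
      -((fun s : ℝ => s ^ (d - 1) * |deriv u s| ^ (p - 1)) / fun s : ℝ => s ^ (d - 1)) := by
    filter_upwards [lt_mem_nhds hr] with s hs
    have : s ^ (d - 1) ≠ 0 := (pow_pos hs _).ne'
    rw [hu.pFlux_eq hp hs]
    simp only [Pi.neg_apply, Pi.div_apply]
    field_simp
  have h' := h.congr_of_eventuallyEq heq
  refine ⟨h'.differentiableAt, ?_⟩
  rw [h'.deriv, hu.pFlux_eq hp hr]
  field_simp
  ring

lemma flux_nonneg {r : ℝ} (hr : 0 < r) : 0 ≤ r ^ (d - 1) * |deriv u r| ^ (p - 1) := by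
  positivity

lemma flux_antitoneOn (hu : IsC1NonincreasingSolution d p q u) (hp : 1 < p) (hq : 0 < q) :
    AntitoneOn (fun r : ℝ => r ^ (d - 1) * |deriv u r| ^ (p - 1)) (Ioi 0) := by
  refine antitoneOn_of_deriv_nonpos (convex_Ioi 0)
    (fun r hr => (hu.hasDerivAt_flux hp hq hr).continuousAt.continuousWithinAt) ?_ ?_ <;>
  rw [interior_Ioi] <;> intro r hr
  · exact (hu.hasDerivAt_flux hp hq hr).differentiableAt.differentiableWithinAt
  · rw [(hu.hasDerivAt_flux hp hq hr).deriv]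
    exact neg_nonpos.2 (hu.source_nonneg hr)

/-- The weighted flux is nonnegative and decreasing: once zero it stays zero. Then `u` is constant
from `r` on, and its limit forces `u r ≤ 0`. -/
theorem deriv_neg (hu : IsC1NonincreasingSolution d p q u) (hp : 1 < p) (hq : 0 < q) {r : ℝ}
    (hr : 0 < r) (hur : 0 < u r) : deriv u r < 0 := by
  refine lt_of_le_of_ne (hu.deriv_nonpos hr) fun h0 => ?_
  have hzero : ∀ s, r ≤ s → deriv u s = 0 := by
    intro s hs
    have hs0 := hr.trans_le hs
    have h1 : s ^ (d - 1) * |deriv u s| ^ (p - 1) ≤ r ^ (d - 1) * |deriv u r| ^ (p - 1) :=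
      hu.flux_antitoneOn hp hq hr hs0 hs
    rw [h0, abs_zero, Real.zero_rpow (by linarith), mul_zero] at h1
    have h2 := le_antisymm h1 (flux_nonneg hs0)
    have h3 := (mul_eq_zero.1 h2).resolve_left (pow_pos hs0 _).ne'
    exact abs_eq_zero.1 ((Real.rpow_eq_zero (abs_nonneg _) (by linarith)).1 h3)
  have hmono : MonotoneOn u (Ici r) := by
    refine monotoneOn_of_deriv_nonneg (convex_Ici r) (fun s hs =>
      (hu.hasDerivAt (hr.trans_le hs)).continuousAt.continuousWithinAt) ?_ ?_ <;>
    rw [interior_Ici] <;> intro s hs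
    · exact (hu.hasDerivAt (hr.trans hs)).differentiableAt.differentiableWithinAt
    · exact (hzero s (le_of_lt hs)).ge
  have : u r ≤ 0 := ge_of_tendsto hu.tendsto_atTop
    ((eventually_ge_atTop r).mono fun s hs => hmono self_mem_Ici hs hs)
  linarith

/-- Since the source is at most `1` on `(0, 1)`, `W(s) + s` increases there; this bounds the
decreasing `W` near `0`. -/
lemma exists_tendsto_flux_zero (hu : IsC1NonincreasingSolution d p q u) (hp : 1 < p) (hq : 0 < q) :
    ∃ ℓ, Tendsto (fun r : ℝ => r ^ (d - 1) * |deriv u r| ^ (p - 1)) (𝓝[>] 0) (𝓝 ℓ) := by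
  set W : ℝ → ℝ := fun s => s ^ (d - 1) * |deriv u s| ^ (p - 1) with hW
  have hanti : AntitoneOn W (Ioi 0) := hu.flux_antitoneOn hp hq
  have hder : ∀ r : ℝ, 0 < r → HasDerivAt (fun s => W s + s) (-(r ^ (d - 1) * u r ^ q) + 1) r :=
    fun r hr => (hu.hasDerivAt_flux hp hq hr).add (hasDerivAt_id r)
  have hmono : MonotoneOn (fun s => W s + s) (Ioc 0 1) := by
    refine monotoneOn_of_deriv_nonneg (convex_Ioc 0 1)
      (fun s hs => (hder s hs.1).continuousAt.continuousWithinAt) ?_ ?_ <;>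
    rw [interior_Ioc] <;> intro s hs
    · exact (hder s hs.1).differentiableAt.differentiableWithinAt
    · rw [(hder s hs.1).deriv]
      have : s ^ (d - 1) * u s ^ q ≤ 1 := mul_le_one₀ (pow_le_one₀ hs.1.le hs.2.le)
        (Real.rpow_nonneg (hu.nonneg hs.1) _)
        (Real.rpow_le_one (hu.nonneg hs.1) (hu.le_one hs.1) hq.le)
      linarith
  refine ⟨_, hanti.tendsto_nhdsGT ⟨W 1 + 1, ?_⟩⟩
  rintro _ ⟨r, hr, rfl⟩
  have hr : 0 < r := hr
  rcases le_total r 1 with h | h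
  · have := hmono ⟨hr, h⟩ ⟨one_pos, le_rfl⟩ h
    simp only at this
    linarith
  · have := hanti (mem_Ioi.2 one_pos) hr h
    linarith

/-- If `W ≥ ε` throughout, then `r^(d-1) ≤ r^(p-1)` for `r ≥ 1` gives `-u' ≥ δ / r`, and `u` would
fall logarithmically to minus infinity. -/
lemma tendsto_flux_atTop (hu : IsC1NonincreasingSolution d p q u) (hd : 1 ≤ d)
    (hp : (d : ℝ) < p) (hq : 0 < q) :
    Tendsto (fun r : ℝ => r ^ (d - 1) * |deriv u r| ^ (p - 1)) atTop (𝓝 0) := by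
  have hd1 : (1 : ℝ) ≤ d := by exact_mod_cast hd
  have hp1 : 0 < p - 1 := by linarith
  set W : ℝ → ℝ := fun s => s ^ (d - 1) * |deriv u s| ^ (p - 1) with hW
  have hanti : AntitoneOn W (Ioi 0) := hu.flux_antitoneOn (by linarith) hq
  have key : ∀ ε > 0, ∃ R, 0 < R ∧ W R < ε := by
    intro ε hε
    by_contra! hge
    set δ := ε ^ (p - 1)⁻¹ with hδ
    have hδ0 : 0 < δ := Real.rpow_pos_of_pos hε _
    have hslope : ∀ r, 1 ≤ r → δ / r ≤ -deriv u r := by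
      intro r hr
      have hr0 : 0 < r := one_pos.trans_le hr
      have h1 : ε ≤ (r * |deriv u r|) ^ (p - 1) := by
        rw [Real.mul_rpow hr0.le (abs_nonneg _)]
        refine (hge r hr0).trans (mul_le_mul_of_nonneg_right ?_ (by positivity))
        rw [← Real.rpow_natCast, Nat.cast_sub hd, Nat.cast_one]
        exact Real.rpow_le_rpow_of_exponent_le hr (by linarith)
      have h2 : δ ≤ r * |deriv u r| := by
        rw [hδ, Real.rpow_inv_le_iff_of_pos hε.le (by positivity) hp1]
        exact h1
      rw [div_le_iff₀ hr0, ← abs_of_nonpos (hu.deriv_nonpos hr0)]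
      linarith
    have hder : ∀ r : ℝ, 0 < r → HasDerivAt (fun s => u s + δ * Real.log s)
        (deriv u r + δ * r⁻¹) r := fun r hr =>
      (hu.hasDerivAt hr).add ((Real.hasDerivAt_log hr.ne').const_mul δ)
    have hA : AntitoneOn (fun s => u s + δ * Real.log s) (Ici 1) := by
      refine antitoneOn_of_deriv_nonpos (convex_Ici 1) (fun s hs =>
        (hder s (one_pos.trans_le hs)).continuousAt.continuousWithinAt) ?_ ?_ <;>
      rw [interior_Ici] <;> intro s hs
      · exact (hder s (one_pos.trans hs)).differentiableAt.differentiableWithinAt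
      · rw [(hder s (one_pos.trans hs)).deriv]
        have := hslope s (le_of_lt hs)
        rw [div_eq_mul_inv] at this
        linarith
    obtain ⟨R, hR1, hR⟩ := ((eventually_ge_atTop 1).and
      (Real.tendsto_log_atTop.eventually_gt_atTop (1 / δ))).exists
    have h1 := hA self_mem_Ici (mem_Ici.2 hR1) hR1
    simp only [Real.log_one, mul_zero, add_zero] at h1
    have h2 : 1 < δ * Real.log R := by rwa [div_lt_iff₀' hδ0] at hR
    linarith [hu.nonneg (one_pos.trans_le hR1), hu.le_one one_pos]
  rw [Metric.tendsto_atTop]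
  intro ε hε
  obtain ⟨R, hR, hRε⟩ := key ε hε
  refine ⟨R, fun r hr => ?_⟩
  have hr0 := hR.trans_le hr
  rw [Real.dist_eq, sub_zero, abs_of_nonneg (flux_nonneg hr0)]
  exact (hanti hR hr0 hr).trans_lt hRε

/-- This is the equation tested with `u` itself: `-u' |u'|^(p-1) = |u'|^p` because `u' ≤ 0`. -/
lemma hasDerivAt_mul_flux (hu : IsC1NonincreasingSolution d p q u) (hp : 1 < p) (hq : 0 < q)
    {r : ℝ} (hr : 0 < r) :
    HasDerivAt (fun s : ℝ => u s * (s ^ (d - 1) * |deriv u s| ^ (p - 1)))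
      (-(r ^ (d - 1) * |deriv u r| ^ p + r ^ (d - 1) * u r ^ (q + 1))) r := by
  refine ((hu.hasDerivAt hr).mul (hu.hasDerivAt_flux hp hq hr)).congr_deriv ?_
  have h1 : |deriv u r| ^ p = |deriv u r| ^ (p - 1) * -deriv u r := by
    have h := Real.rpow_add_one' (abs_nonneg (deriv u r)) (show (p - 1) + 1 ≠ 0 by linarith)
    rw [sub_add_cancel] at h
    rw [h]
    congr 1
    exact abs_of_nonpos (hu.deriv_nonpos hr)
  rw [h1, Real.rpow_add_one' (hu.nonneg hr) (by linarith)]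
  ring

end IsC1NonincreasingSolution

theorem theorem3p5 (d : ℕ) (hd : 1 ≤ d) (p q : ℝ) (hp : (d : ℝ) < p) (hq : 0 < q) :
    (∃ u : ℝ → ℝ, IsC1NonincreasingSolution d p q u) ∧
    ∀ u : ℝ → ℝ, IsC1NonincreasingSolution d p q u →
      SolvesPointwise d p q u ∧
      (∀ r : ℝ, 0 < r → 0 < u r → deriv u r < 0) ∧
      IntegrableOn (fun r : ℝ => r ^ (d - 1) * |deriv u r| ^ p) (Ioi 0) ∧
      IntegrableOn (fun r : ℝ => r ^ (d - 1) * u r ^ (q + 1)) (Ioi 0) ∧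
      IntegrableOn (fun r : ℝ => r ^ (d - 1) * u r ^ q) (Ioi 0) ∧
      Tendsto (fun r : ℝ => r ^ (d - 1) * |deriv u r| ^ (p - 1)) (𝓝[>] 0)
        (𝓝 (∫ r in Ioi (0 : ℝ), r ^ (d - 1) * u r ^ q)) ∧
      (∫ r in Ioi (0 : ℝ), r ^ (d - 1) * |deriv u r| ^ p)
          + (∫ r in Ioi (0 : ℝ), r ^ (d - 1) * u r ^ (q + 1))
        = ∫ r in Ioi (0 : ℝ), r ^ (d - 1) * u r ^ q := by
  refine ⟨exists_isC1NonincreasingSolution hd hp hq, fun u hu => ?_⟩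
  have hp1 : 1 < p := lt_of_le_of_lt (by exact_mod_cast hd) hp
  obtain ⟨ℓ, hℓ⟩ := hu.exists_tendsto_flux_zero hp1 hq
  have hinf := hu.tendsto_flux_atTop hd hp hq
  obtain ⟨hI, hIeq⟩ := integral_Ioi_of_hasDerivAt_of_nonpos_of_tendsto
    (fun r hr => hu.hasDerivAt_flux hp1 hq hr) (fun r hr => neg_nonpos.2 (hu.source_nonneg hr))
    hℓ hinf
  have hIq : IntegrableOn (fun r : ℝ => r ^ (d - 1) * u r ^ q) (Ioi 0) :=
    hI.neg.congr_fun (fun r _ => neg_neg _) measurableSet_Ioi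
  rw [integral_neg] at hIeq
  have hℓ_eq : ∫ r in Ioi (0 : ℝ), r ^ (d - 1) * u r ^ q = ℓ := by linarith
  have hpos1 : ∀ r ∈ Ioi (0 : ℝ), 0 ≤ r ^ (d - 1) * |deriv u r| ^ p := fun r hr => by
    have hr : 0 < r := hr
    positivity
  have hpos2 : ∀ r ∈ Ioi (0 : ℝ), 0 ≤ r ^ (d - 1) * u r ^ (q + 1) := fun r hr =>
    mul_nonneg (pow_nonneg (le_of_lt hr) _) (Real.rpow_nonneg (hu.nonneg hr) _)
  -- The boundary values of `u W` are `1 * ℓ` at `0` and `0 * 0` at infinity, so this integral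
  -- equals that of the source.
  obtain ⟨hJ, hJeq⟩ := integral_Ioi_of_hasDerivAt_of_nonpos_of_tendsto
    (fun r hr => hu.hasDerivAt_mul_flux hp1 hq hr)
    (fun r hr => neg_nonpos.2 (add_nonneg (hpos1 r hr) (hpos2 r hr)))
    (hu.tendsto_zero.mul hℓ) (hu.tendsto_atTop.mul hinf)
  have hJ' : IntegrableOn (fun r : ℝ => r ^ (d - 1) * |deriv u r| ^ p
      + r ^ (d - 1) * u r ^ (q + 1)) (Ioi 0) :=
    hJ.neg.congr_fun (fun r _ => neg_neg _) measurableSet_Ioi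
  have hc2 : ContinuousOn (fun r : ℝ => r ^ (d - 1) * u r ^ (q + 1)) (Ioi 0) :=
    (continuous_pow _).continuousOn.mul
      (hu.contDiffOn.continuousOn.rpow_const fun _ _ => Or.inr (by linarith))
  have hI2 : IntegrableOn (fun r : ℝ => r ^ (d - 1) * u r ^ (q + 1)) (Ioi 0) := by
    refine hJ'.mono' (hc2.aestronglyMeasurable measurableSet_Ioi)
      ((ae_restrict_iff' measurableSet_Ioi).2 (ae_of_all _ fun r hr => ?_))
    rw [Real.norm_of_nonneg (hpos2 r hr)]
    exact le_add_of_nonneg_left (hpos1 r hr)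
  have hI1 : IntegrableOn (fun r : ℝ => r ^ (d - 1) * |deriv u r| ^ p) (Ioi 0) :=
    (hJ'.sub hI2).congr_fun (fun r _ => add_sub_cancel_right _ _) measurableSet_Ioi
  refine ⟨hu.solvesPointwise hd hp1 hq, fun r hr hur => hu.deriv_neg hp1 hq hr hur, hI1, hI2, hIq,
    hℓ_eq ▸ hℓ, ?_⟩
  rw [integral_neg, integral_add hI1 hI2] at hJeq
  rw [hℓ_eq]
  linarith
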